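/- Let $p$ be a prime, $k$ a field of characteristic $p$, and let $n,r\ge 0$ be integers with $p>n$. Put $d=np^r$. **Conventions.** A *strict polynomial functor* $T$, homogeneous of degree $d$, assigns to each finite-dimensional $k$-space $V$ a finite-dimensional space $T(V)$, and to each pair $V,W$ a homogeneous polynomial map $\mathrm{Hom}(V,W)\to\mathrm{Hom}(T(V),T(W))$ of degree $d$, compatibly with identities and composition. Examples are $\otimes^n$, $\Gamma^n(V)=(V^{\otimes n})^{\mathfrak S_n}$, $S^n(V)=(V^{\otimes n})_{\mathfrak S_n}$, $\Lambda^n$ (all of degree $n$), and the Frobenius twist $I^{(r)}$ (of degree $p^r$), $V\mapsto V^{(r)}=k\otimes_{\phi^r}V$, where $\phi$ is the Frobenius of $k$. A *strict polynomial bifunctor* $T(V,W)$, contravariant in $V$ and covariant in $W$, is defined in the same way by polynomial maps $\mathrm{Hom}(V,V')\times\mathrm{Hom}(W,W')\to\mathrm{Hom}(T(V',W),T(V,W'))$; those of bounded degree form a $k$-linear abelian category $\mathcal P$. Let $g\ell(V,W)=\mathrm{Hom}_k(V,W)$. For a strict polynomial functor $T$ homogeneous of degree $d$ write $T(g\ell)=T\circ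 g\ell$ and $$\mathrm H^i_{\mathcal P}(\mathrm{GL},T(g\ell))=\mathrm{Ext}^i_{\mathcal P}(\Gamma^d\circ g\ell,\;T\circ g\ell).$$ For $F\in\{\otimes^n,S^n,\Lambda^n,S^\lambda\}$ put $F(g\ell^{(r)})=F\circ I^{(r)}\circ g\ell$, and $g\ell^{\otimes n(r)}=\otimes^n\circ I^{(r)}\circ g\ell$. The group $\mathfrak S_n$ acts on $g\ell^{\otimes n(r)}$ by permuting tensor factors, hence on $\mathrm H^i_{\mathcal P}(\mathrm{GL},g\ell^{\otimes n(r)})$. A left $k\mathfrak S_n$-module $X$ is regarded as a right module through $x\cdot\sigma=\sigma^{-1}x$. For a partition $\lambda$ of $n$ choose any bijective numbering of the boxes of its Young diagram by $1,\dots,n$; let $a_\lambda\in k\mathfrak S_n$ be the sum of the permutations preserving the rows, $b_\lambda$ the alternating (signed) sum of the permutations preserving the columns, and $c_\lambda=a_\lambda b_\lambda$. For a $k\mathfrak S_n$-module $W$ and a finite-dimensional space $V$ put $$s^\lambda(W)=(k\mathfrak S_n\cdot c_\lambda)\otimes_{k\mathfrak S_n}W,\qquad S^\lambda(V)=s^\lambda(V^{\otimes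 n}).$$ Each $x\in k\mathfrak S_n c_\lambda$ gives a morphism $\iota_x:g\ell^{\otimes n(r)}\to S^\lambda(g\ell^{(r)})$, $w\mapsto x\otimes w$. **Statement.** For every partition $\lambda$ of $n$, every such numbering and every $i\ge0$, there is a $k$-linear isomorphism $$s^\lambda\big(\mathrm H^i_{\mathcal P}(\mathrm{GL},g\ell^{\otimes n(r)})\big)\;\cong\;\mathrm H^i_{\mathcal P}(\mathrm{GL},S^\lambda(g\ell^{(r)})),\qquad x\otimes w\mapsto(\iota_x)_*(w).$$ In particular, for every $i\ge 0$ (and every numbering of the diagrams of $(n)$ and $(1,\dots,1)$), $$\mathrm H^i_{\mathcal P}(\mathrm{GL},S^n(g\ell^{(r)}))\cong s^{(n)}\big(\mathrm H^i_{\mathcal P}(\mathrm{GL},g\ell^{\otimes n(r)})\big)\cong k\otimes_{k\mathfrak S_n}\mathrm H^i_{\mathcal P}(\mathrm{GL},g\ell^{\otimes n(r)}),$$ $$\mathrm H^i_{\mathcal P}(\mathrm{GL},\Lambda^n(g\ell^{(r)}))\cong s^{(1,\dots,1)}\big(\mathrm H^i_{\mathcal P}(\mathrm{GL},g\ell^{\otimes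 n(r)})\big)\cong k_{\mathrm{sgn}}\otimes_{k\mathfrak S_n}\mathrm H^i_{\mathcal P}(\mathrm{GL},g\ell^{\otimes n(r)}),$$ where $k$ and $k_{\mathrm{sgn}}$ are the trivial and the sign representation; the resulting isomorphisms from $k\otimes_{k\mathfrak S_n}-$ and $k_{\mathrm{sgn}}\otimes_{k\mathfrak S_n}-$ may be taken to be $c\otimes w\mapsto c\,\pi_*(w)$, with $\pi$ the canonical projection from $g\ell^{\otimes n(r)}$ to $S^n(g\ell^{(r)})$, respectively $\Lambda^n(g\ell^{(r)})$. -/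

import Mathlib

open CategoryTheory
open scoped TensorProduct

universe u

noncomputable section

namespace StrictPoly

/-! ### Extension of scalars -/

section BaseChange

variable {k : Type*} [Field k] {A B : Type*} [CommRing A] [Algebra k A] [CommRing B] [Algebra k B]
  {M N P : Type*} [AddCommGroup M] [Module k M] [AddCommGroup N] [Module k N]
  [AddCommGroup P] [Module k P]

/-- The map `φ ⊗ id : A ⊗ M → B ⊗ M` attached to a morphism `φ : A → B` of `k`-algebras. -/
def scalarExt (φ : A →ₐ[k] B) (M : Type*) [AddCommGroup M] [Module k M] :
    A ⊗[k] M →ₗ[k] B ⊗[k] M :=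
  φ.toLinearMap.rTensor M

/-- For `f : A ⊗ M → A ⊗ N` and `f' : B ⊗ M → B ⊗ N`, the statement that `f'` is the extension of
scalars of `f` along `φ : A → B` (such an `f'` exists and is unique). -/
def IsExt (φ : A →ₐ[k] B) (f : A ⊗[k] M →ₗ[A] A ⊗[k] N) (f' : B ⊗[k] M →ₗ[B] B ⊗[k] N) : Prop :=
  ∀ x : A ⊗[k] M, f' (scalarExt φ M x) = scalarExt φ N (f x)

@[simp] lemma scalarExt_tmul (φ : A →ₐ[k] B) (a : A) (m : M) :
    scalarExt φ M (a ⊗ₜ m) = φ a ⊗ₜ m := rfl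

lemma scalarExt_smul (φ : A →ₐ[k] B) (a : A) (x : A ⊗[k] M) :
    scalarExt φ M (a • x) = φ a • scalarExt φ M x := by
  induction x with
  | zero => simp
  | tmul b m => simp [TensorProduct.smul_tmul']
  | add x y hx hy => simp only [smul_add, map_add, hx, hy]

lemma hom_ext_one {Q : Type*} [AddCommGroup Q] [Module A Q] {f g : A ⊗[k] M →ₗ[A] Q}
    (h : ∀ m : M, f (1 ⊗ₜ m) = g (1 ⊗ₜ m)) : f = g := by
  ext x
  induction x with
  | zero => simp
  | tmul a m =>
    have : a ⊗ₜ[k] m = a • ((1 : A) ⊗ₜ[k] m) := by simp [TensorProduct.smul_tmul']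
    rw [this, map_smul, map_smul, h]
  | add x y hx hy => simp only [map_add, hx, hy]

lemma isExt_of_one {φ : A →ₐ[k] B} {f : A ⊗[k] M →ₗ[A] A ⊗[k] N} {f' : B ⊗[k] M →ₗ[B] B ⊗[k] N}
    (h : ∀ m : M, f' (1 ⊗ₜ m) = scalarExt φ N (f (1 ⊗ₜ m))) : IsExt φ f f' := by
  intro x
  induction x with
  | zero => simp
  | tmul a m =>
    have h1 : a ⊗ₜ[k] m = a • ((1 : A) ⊗ₜ[k] m) := by simp [TensorProduct.smul_tmul']
    rw [h1, scalarExt_smul, map_smul, map_smul, scalarExt_smul, scalarExt_tmul, map_one, h]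
  | add x y hx hy => simp only [map_add, hx, hy]

lemma IsExt.one {φ : A →ₐ[k] B} {f : A ⊗[k] M →ₗ[A] A ⊗[k] N} {f' : B ⊗[k] M →ₗ[B] B ⊗[k] N}
    (h : IsExt φ f f') (m : M) : f' (1 ⊗ₜ m) = scalarExt φ N (f (1 ⊗ₜ m)) := by
  have := h (1 ⊗ₜ m)
  simpa using this

lemma scalarExt_baseChange (φ : A →ₐ[k] B) (l : M →ₗ[k] N) (x : A ⊗[k] M) :
    scalarExt φ N (l.baseChange A x) = l.baseChange B (scalarExt φ M x) := by
  induction x with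
  | zero => simp
  | tmul a m => simp
  | add x y hx hy => simp only [map_add, hx, hy]

lemma baseChange_injective {l : M →ₗ[k] N} (h : Function.Injective l) :
    Function.Injective (l.baseChange A) := by
  obtain ⟨r, hr⟩ := l.exists_leftInverse_of_injective (LinearMap.ker_eq_bot.mpr h)
  have : (r.baseChange A).comp (l.baseChange A) = LinearMap.id := by
    rw [← LinearMap.baseChange_comp, hr, LinearMap.baseChange_id]
  exact Function.LeftInverse.injective (fun x => LinearMap.congr_fun this x)

/-- Evaluation of the first tensor factor at a linear form. -/
def slice (M : Type*) [AddCommGroup M] [Module k M] (ξ : A →ₗ[k] k) : A ⊗[k] M →ₗ[k] M :=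
  (TensorProduct.lid k M).toLinearMap ∘ₗ ξ.rTensor M

lemma slice_baseChange (ξ : A →ₗ[k] k) (l : M →ₗ[k] N) (x : A ⊗[k] M) :
    slice N ξ (l.baseChange A x) = l (slice M ξ x) := by
  induction x with
  | zero => simp
  | tmul a m => simp [slice]
  | add x y hx hy => simp only [map_add, hx, hy]

lemma eq_zero_of_slice {x : A ⊗[k] M} (h : ∀ ξ : A →ₗ[k] k, slice M ξ x = 0) : x = 0 := by
  classical
  let b := Module.Basis.ofVectorSpace k A
  let e := TensorProduct.equivFinsuppOfBasisLeft (N := M) b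
  apply e.injective
  rw [map_zero]
  ext i
  have h2 : ∀ y : A ⊗[k] M, e y i = slice M (b.coord i) y := by
    intro y
    induction y with
    | zero => simp
    | tmul a m => simp [e, slice, TensorProduct.equivFinsuppOfBasisLeft_apply_tmul]
    | add x y hx hy => simp only [map_add, Finsupp.add_apply, hx, hy]
  rw [h2, h]; rfl

lemma mem_range_baseChange {l : M →ₗ[k] N} {x : A ⊗[k] N}
    (h : ∀ ξ : A →ₗ[k] k, slice N ξ x ∈ LinearMap.range l) :
    x ∈ LinearMap.range (l.baseChange A) := by
  have hex : Function.Exact l (LinearMap.range l).mkQ := by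
    rw [LinearMap.exact_iff, Submodule.ker_mkQ]
  have h2 := lTensor_exact A hex (Submodule.mkQ_surjective _)
  have h3 : (LinearMap.range l).mkQ.baseChange A x = 0 := by
    apply eq_zero_of_slice
    intro ξ
    rw [slice_baseChange]
    simpa using h ξ
  obtain ⟨y, hy⟩ := (h2 x).mp h3
  exact ⟨y, hy⟩

lemma exists_lift_of_range_le {Q : Type*} [AddCommGroup Q] [Module A Q]
    {l : M →ₗ[k] N} (hl : Function.Injective l) (f : Q →ₗ[A] A ⊗[k] N)
    (h : ∀ x, f x ∈ LinearMap.range (l.baseChange A)) :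
    ∃ g : Q →ₗ[A] A ⊗[k] M, (l.baseChange A) ∘ₗ g = f := by
  let e := LinearEquiv.ofInjective (l.baseChange A) (baseChange_injective hl)
  refine ⟨e.symm.toLinearMap ∘ₗ f.codRestrict _ h, ?_⟩
  ext x
  have := LinearEquiv.ofInjective_symm_apply (l.baseChange A) (h := baseChange_injective hl)
    (f.codRestrict _ h x)
  exact this

end BaseChange

/-! ### Tensor powers of `A`-linear maps -/

section TensorPower

variable {k : Type*} [Field k] {A B : Type*} [CommRing A] [Algebra k A] [CommRing B] [Algebra k B]
  {M N P : Type*} [AddCommGroup M] [Module k M] [AddCommGroup N] [Module k N]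
  [AddCommGroup P] [Module k P] {n : ℕ}

/-- The projection of the tensor algebra onto its component of degree `n`. -/
def tensorAlgebraProj (n : ℕ) (N : Type*) [AddCommGroup N] [Module k N] :
    TensorAlgebra k N →ₗ[k] ⨂[k]^n N :=
  DirectSum.component k ℕ (fun n => ⨂[k]^n N) n ∘ₗ TensorAlgebra.toDirectSum.toLinearMap

/-- The `A`-multilinear map `(A ⊗ N)ⁿ → A ⊗ N^{⊗ n}`,
`(aᵢ ⊗ xᵢ)ᵢ ↦ (∏ aᵢ) ⊗ (x₁ ⊗ ⋯ ⊗ xₙ)`. -/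
def tensorMul (A : Type*) [CommRing A] [Algebra k A] (n : ℕ) (N : Type*)
    [AddCommGroup N] [Module k N] :
    MultilinearMap A (fun _ : Fin n => A ⊗[k] N) (A ⊗[k] ⨂[k]^n N) :=
  ((tensorAlgebraProj n N).baseChange A).compMultilinearMap
    ((MultilinearMap.mkPiAlgebraFin A n (A ⊗[k] TensorAlgebra k N)).compLinearMap
      fun _ => (TensorAlgebra.ι k).baseChange A)

lemma tensorMul_one (x : Fin n → N) :
    tensorMul A n N (fun i => 1 ⊗ₜ[k] x i) = 1 ⊗ₜ[k] PiTensorProduct.tprod k x := by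
  have h : (List.ofFn fun i => (1 : A) ⊗ₜ[k] TensorAlgebra.ι k (x i)).prod =
      (1 : A) ⊗ₜ[k] (List.ofFn fun i => TensorAlgebra.ι k (x i)).prod := by
    have := (map_list_prod (Algebra.TensorProduct.includeRight : TensorAlgebra k N →ₐ[k] A ⊗[k] _)
      (List.ofFn fun i => TensorAlgebra.ι k (x i)))
    rw [List.map_ofFn] at this
    exact this.symm
  simp only [tensorMul, LinearMap.compMultilinearMap_apply, MultilinearMap.compLinearMap_apply,
    LinearMap.baseChange_tmul, MultilinearMap.mkPiAlgebraFin_apply, h]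
  rw [← TensorAlgebra.tprod_apply]
  simp only [tensorAlgebraProj, LinearMap.comp_apply, AlgHom.toLinearMap_apply,
    TensorAlgebra.toDirectSum_tensorPower_tprod]
  congr 1
  exact DirectSum.component.lof_self (R := k) (M := fun n => ⨂[k]^n N) n _

lemma multilinear_ext_one {Q : Type*} [AddCommGroup Q] [Module A Q]
    {f g : MultilinearMap A (fun _ : Fin n => A ⊗[k] M) Q}
    (h : ∀ m : Fin n → M, f (fun i => 1 ⊗ₜ m i) = g (fun i => 1 ⊗ₜ m i)) : f = g := by
  refine Module.Basis.ext_multilinear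
    (e := fun _ => (Module.Basis.ofVectorSpace k M).baseChange A) fun v => ?_
  simpa using h fun i => Module.Basis.ofVectorSpace k M (v i)

lemma scalarExt_tensorMul (φ : A →ₐ[k] B) (x : Fin n → A ⊗[k] N) :
    tensorMul B n N (fun i => scalarExt φ N (x i)) = scalarExt φ _ (tensorMul A n N x) := by
  let Φ : A ⊗[k] TensorAlgebra k N →ₐ[k] B ⊗[k] TensorAlgebra k N :=
    Algebra.TensorProduct.map φ (AlgHom.id k _)
  have hΦ : ∀ y, Φ y = scalarExt φ _ y := by
    intro y
    induction y with
    | zero => simp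
    | tmul a m => simp [Φ]
    | add x y hx hy => simp only [map_add, hx, hy]
  simp only [tensorMul, LinearMap.compMultilinearMap_apply, MultilinearMap.compLinearMap_apply,
    MultilinearMap.mkPiAlgebraFin_apply]
  rw [scalarExt_baseChange, ← hΦ, map_list_prod Φ, List.map_ofFn]
  simp only [Function.comp_def, hΦ, scalarExt_baseChange]

/-- The `n`-th tensor power `A ⊗ M^{⊗ n} → A ⊗ N^{⊗ n}` of an `A`-linear map `A ⊗ M → A ⊗ N`. -/
def tensorPowMap (n : ℕ) (f : A ⊗[k] M →ₗ[A] A ⊗[k] N) :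
    A ⊗[k] (⨂[k]^n M) →ₗ[A] A ⊗[k] (⨂[k]^n N) :=
  (PiTensorProduct.lift
    (((tensorMul A n N).compLinearMap fun _ => f).restrictScalars k |>.compLinearMap
      fun _ => TensorProduct.mk k A M 1)).liftBaseChange A

lemma tensorPowMap_one (f : A ⊗[k] M →ₗ[A] A ⊗[k] N) (m : Fin n → M) :
    tensorPowMap n f (1 ⊗ₜ PiTensorProduct.tprod k m) =
      tensorMul A n N (fun i => f (1 ⊗ₜ m i)) := by
  simp [tensorPowMap]

lemma tensorPowMap_tensorMul (f : A ⊗[k] M →ₗ[A] A ⊗[k] N) (x : Fin n → A ⊗[k] M) :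
    tensorPowMap n f (tensorMul A n M x) = tensorMul A n N (fun i => f (x i)) := by
  have : (tensorPowMap n f).compMultilinearMap (tensorMul A n M) =
      (tensorMul A n N).compLinearMap fun _ => f := by
    apply multilinear_ext_one
    intro m
    simp [tensorMul_one, tensorPowMap_one]
  exact congrArg (fun g => g x) this

lemma tensor_hom_ext {Q : Type*} [AddCommGroup Q] [Module A Q]
    {f g : A ⊗[k] (⨂[k]^n M) →ₗ[A] Q}
    (h : ∀ m : Fin n → M, f (1 ⊗ₜ PiTensorProduct.tprod k m) =
      g (1 ⊗ₜ PiTensorProduct.tprod k m)) : f = g := by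
  apply hom_ext_one
  intro y
  induction y using PiTensorProduct.induction_on with
  | smul_tprod r m =>
    rw [TensorProduct.tmul_smul, ← algebraMap_smul A r, map_smul, map_smul, h]
  | add x y hx hy => simp only [TensorProduct.tmul_add, map_add, hx, hy]

lemma tensorPowMap_id : tensorPowMap n (LinearMap.id : A ⊗[k] M →ₗ[A] A ⊗[k] M) =
    LinearMap.id := by
  apply tensor_hom_ext
  intro m
  rw [tensorPowMap_one]
  simp [tensorMul_one]

lemma tensorPowMap_comp (g : A ⊗[k] N →ₗ[A] A ⊗[k] P) (f : A ⊗[k] M →ₗ[A] A ⊗[k] N) :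
    tensorPowMap n (g ∘ₗ f) = tensorPowMap n g ∘ₗ tensorPowMap n f := by
  apply tensor_hom_ext
  intro m
  simp [tensorPowMap_one, tensorPowMap_tensorMul]

lemma tensorPowMap_smul (a : A) (f : A ⊗[k] M →ₗ[A] A ⊗[k] N) :
    tensorPowMap n (a • f) = a ^ n • tensorPowMap n f := by
  apply tensor_hom_ext
  intro m
  simp only [tensorPowMap_one, LinearMap.smul_apply]
  rw [MultilinearMap.map_smul_univ (tensorMul A n N) (fun _ => a)]
  simp

lemma isExt_tensorPowMap {φ : A →ₐ[k] B} {f : A ⊗[k] M →ₗ[A] A ⊗[k] N}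
    {f' : B ⊗[k] M →ₗ[B] B ⊗[k] N} (h : IsExt φ f f') :
    IsExt φ (tensorPowMap n f) (tensorPowMap n f') := by
  apply isExt_of_one
  intro y
  induction y using PiTensorProduct.induction_on with
  | smul_tprod r m =>
    simp only [TensorProduct.tmul_smul, LinearMap.map_smul_of_tower, tensorPowMap_one, h.one,
      scalarExt_tensorMul]
  | add x y hx hy => simp only [TensorProduct.tmul_add, map_add, hx, hy]

/-- The left action of the symmetric group on `M^{⊗ n}` by permutation of the tensor factors,
`σ (x₁ ⊗ ⋯ ⊗ xₙ) = x_{σ⁻¹(1)} ⊗ ⋯ ⊗ x_{σ⁻¹(n)}`. -/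
def permRep (k : Type*) [Field k] (n : ℕ) (M : Type*) [AddCommGroup M] [Module k M] :
    Representation k (Equiv.Perm (Fin n)) (⨂[k]^n M) where
  toFun σ := (PiTensorProduct.reindex k (fun _ : Fin n => M) σ).toLinearMap
  map_one' := by
    ext m
    exact PiTensorProduct.reindex_tprod (R := k) (s := fun _ : Fin n => M) 1 m
  map_mul' σ τ := by
    ext m
    simp only [LinearMap.compMultilinearMap_apply, Module.End.mul_apply, LinearEquiv.coe_coe,
      PiTensorProduct.reindex_tprod]
    rfl

lemma permRep_tprod (σ : Equiv.Perm (Fin n)) (m : Fin n → M) :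
    permRep k n M σ (PiTensorProduct.tprod k m) =
      PiTensorProduct.tprod k fun i => m (σ.symm i) := by
  simp [permRep, PiTensorProduct.reindex_tprod]

lemma permRep_tensorMul (σ : Equiv.Perm (Fin n)) (x : Fin n → A ⊗[k] M) :
    (permRep k n M σ).baseChange A (tensorMul A n M x) =
      tensorMul A n M fun i => x (σ.symm i) := by
  have : ((permRep k n M σ).baseChange A).compMultilinearMap (tensorMul A n M) =
      (tensorMul A n M).domDomCongr σ.symm := by
    apply multilinear_ext_one
    intro m
    simp [tensorMul_one, permRep_tprod]
  exact congrArg (fun g => g x) this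

lemma permRep_comp_tensorPowMap (σ : Equiv.Perm (Fin n)) (f : A ⊗[k] M →ₗ[A] A ⊗[k] N) :
    (permRep k n N σ).baseChange A ∘ₗ tensorPowMap n f =
      tensorPowMap n f ∘ₗ (permRep k n M σ).baseChange A := by
  apply tensor_hom_ext
  intro m
  simp [tensorPowMap_one, permRep_tensorMul, permRep_tprod]

/-- The canonical projection `M^{⊗ n} → Λⁿ M`. -/
def extProj (k : Type*) [Field k] (n : ℕ) (M : Type*) [AddCommGroup M] [Module k M] :
    (⨂[k]^n M) →ₗ[k] ⋀[k]^n M :=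
  PiTensorProduct.lift (exteriorPower.ιMulti k n (M := M)).toMultilinearMap

lemma extProj_tprod (m : Fin n → M) :
    extProj k n M (PiTensorProduct.tprod k m) = exteriorPower.ιMulti k n m := by
  simp [extProj]

lemma extProj_tensorMul_perm (σ : Equiv.Perm (Fin n)) (x : Fin n → A ⊗[k] M) :
    (extProj k n M).baseChange A (tensorMul A n M fun i => x (σ i)) =
      (Equiv.Perm.sign σ : ℤ) • (extProj k n M).baseChange A (tensorMul A n M x) := by
  rcases Int.units_eq_one_or (Equiv.Perm.sign σ) with hs | hs
  · have : ((extProj k n M).baseChange A).compMultilinearMap ((tensorMul A n M).domDomCongr σ) =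
        ((extProj k n M).baseChange A).compMultilinearMap (tensorMul A n M) := by
      apply multilinear_ext_one
      intro m
      have h1 := AlternatingMap.map_perm (exteriorPower.ιMulti k n (M := M)) m σ
      simp only [Function.comp_def] at h1
      simp [tensorMul_one, extProj_tprod, h1, hs]
    simpa [hs] using congrArg (fun g => g x) this
  · have : ((extProj k n M).baseChange A).compMultilinearMap ((tensorMul A n M).domDomCongr σ) =
        -((extProj k n M).baseChange A).compMultilinearMap (tensorMul A n M) := by
      apply multilinear_ext_one
      intro m
      have h1 := AlternatingMap.map_perm (exteriorPower.ιMulti k n (M := M)) m σ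
      simp only [Function.comp_def] at h1
      simp [tensorMul_one, extProj_tprod, h1, hs, TensorProduct.tmul_neg]
    simpa [hs] using congrArg (fun g => g x) this

lemma multilinear_repeat_eq_zero {Q : Type*} [AddCommGroup Q] [Module A Q]
    (α : MultilinearMap A (fun _ : Fin n => A ⊗[k] M) Q)
    (hanti : ∀ (x : Fin n → A ⊗[k] M) (i j : Fin n), i ≠ j →
      α (fun l => x (Equiv.swap i j l)) = -α x)
    (hrep : ∀ (m : Fin n → M) (i j : Fin n), i ≠ j → m i = m j → α (fun l => 1 ⊗ₜ m l) = 0)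
    (x : Fin n → A ⊗[k] M) (i j : Fin n) (hij : i ≠ j) (hx : x i = x j) : α x = 0 := by
  classical
  -- the entries outside `s` are of the form `1 ⊗ m`
  have key : ∀ s : Finset (Fin n), i ∉ s → j ∉ s → ∀ x : Fin n → A ⊗[k] M, x i = x j →
      (∃ m : Fin n → M, ∀ l ∉ s, x l = 1 ⊗ₜ m l) → α x = 0 := by
    intro s
    induction s using Finset.induction_on with
    | empty =>
      rintro - - x hx ⟨m, hm⟩
      -- replace the entry at `j` by the entry at `i`
      have hxe : x = fun l => 1 ⊗ₜ (Function.update m j (m i)) l := by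
        funext l
        by_cases hl : l = j
        · subst hl
          rw [Function.update_self, ← hx]
          exact hm i (by simp)
        · rw [Function.update_of_ne hl]
          exact hm l (by simp)
      rw [hxe]
      apply hrep _ i j hij
      rw [Function.update_of_ne hij, Function.update_self]
    | insert a s ha ih =>
      intro hi hj x hx ⟨m, hm⟩
      have hia : i ≠ a := fun h => hi (by simp [h])
      have hja : j ≠ a := fun h => hj (by simp [h])
      have hi' : i ∉ s := fun h => hi (by simp [h])
      have hj' : j ∉ s := fun h => hj (by simp [h])
      have : ∀ y : A ⊗[k] M, α (Function.update x a y) = 0 := by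
        intro y
        induction y with
        | zero => exact α.map_update_zero x a
        | tmul b v =>
          have h1 : b ⊗ₜ[k] v = b • ((1 : A) ⊗ₜ[k] v) := by simp [TensorProduct.smul_tmul']
          rw [h1, α.map_update_smul]
          rw [ih hi' hj' (Function.update x a (1 ⊗ₜ v))
            (by rw [Function.update_of_ne hia, Function.update_of_ne hja, hx]), smul_zero]
          refine ⟨Function.update m a v, fun l hl => ?_⟩
          by_cases hla : l = a
          · subst hla; simp
          · rw [Function.update_of_ne hla, Function.update_of_ne hla]
            exact hm l (by simp [hla, hl])
        | add y z hy hz => rw [α.map_update_add, hy, hz, add_zero]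
      have h2 := this (x a)
      rwa [Function.update_eq_self] at h2
  -- reduction to the case where the repeated entry is `1 ⊗ v`
  have key2 : ∀ y : A ⊗[k] M, ∀ x : Fin n → A ⊗[k] M,
      α (Function.update (Function.update x i y) j y) = 0 := by
    intro y
    induction y with
    | zero => intro x; exact α.map_update_zero _ j
    | tmul b v =>
      intro x
      have h1 : b ⊗ₜ[k] v = b • ((1 : A) ⊗ₜ[k] v) := by simp [TensorProduct.smul_tmul']
      rw [h1, α.map_update_smul, Function.update_comm hij, α.map_update_smul]
      rw [key (Finset.univ \ {i, j}) (by simp) (by simp), smul_zero, smul_zero]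
      · simp [Function.update_of_ne hij.symm]
      · refine ⟨fun _ => v, fun l hl => ?_⟩
        have hl' : l = i ∨ l = j := by
          by_contra hc
          exact hl (by simpa using hc)
        rcases hl' with rfl | rfl
        · simp
        · simp [Function.update_of_ne hij.symm]
    | add y z hy hz =>
      intro x
      have hl : ∀ u u' v, α (Function.update (Function.update x i (u + u')) j v) =
          α (Function.update (Function.update x i u) j v) +
            α (Function.update (Function.update x i u') j v) := by
        intro u u' v
        simp only [Function.update_comm hij]
        exact α.map_update_add _ _ _ _
      have hs : α (Function.update (Function.update x i z) j y) =
          -α (Function.update (Function.update x i y) j z) := by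
        rw [← hanti _ i j hij]
        congr 1
        funext l
        by_cases h1 : l = i
        · subst h1; simp [Function.update_of_ne hij]
        · by_cases h2 : l = j
          · subst h2; simp [Function.update_of_ne hij]
          · simp [Equiv.swap_apply_of_ne_of_ne h1 h2, Function.update_of_ne h1,
              Function.update_of_ne h2]
      rw [α.map_update_add, hl, hl, hy, hz, hs]
      simp
  have h3 := key2 (x i) x
  rw [Function.update_eq_self] at h3
  rwa [hx, Function.update_eq_self] at h3

/-- A tensor power of `A`-linear maps induces a map on exterior powers. -/
lemma exists_extPowMap (f : A ⊗[k] M →ₗ[A] A ⊗[k] N) :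
    ∃ g : A ⊗[k] (⋀[k]^n M) →ₗ[A] A ⊗[k] (⋀[k]^n N),
      g ∘ₗ (extProj k n M).baseChange A = (extProj k n N).baseChange A ∘ₗ tensorPowMap n f := by
  let β : MultilinearMap A (fun _ : Fin n => A ⊗[k] N) (A ⊗[k] (⋀[k]^n N)) :=
    ((extProj k n N).baseChange A).compMultilinearMap (tensorMul A n N)
  have hβ : ∀ (x : Fin n → A ⊗[k] N) (i j : Fin n), x i = x j → i ≠ j → β x = 0 := by
    intro x i j hx hij
    refine multilinear_repeat_eq_zero β ?_ ?_ x i j hij hx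
    · intro x i j hij
      have := extProj_tensorMul_perm (Equiv.swap i j) x
      rw [Equiv.Perm.sign_swap hij] at this
      simp only [Units.val_neg, Units.val_one, neg_smul, one_smul] at this
      exact this
    · intro m i j hij hm
      simp [β, tensorMul_one, extProj_tprod,
        AlternatingMap.map_eq_zero_of_eq (exteriorPower.ιMulti k n (M := N)) m hm hij]
  let γ : M [⋀^Fin n]→ₗ[k] A ⊗[k] (⋀[k]^n N) :=
    { ((β.compLinearMap fun _ => f).restrictScalars k).compLinearMap
        fun _ => TensorProduct.mk k A M 1 with
      map_eq_zero_of_eq' := fun v i j hv hij => hβ _ i j (by simp [hv]) hij }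
  refine ⟨(exteriorPower.alternatingMapLinearEquiv γ).liftBaseChange A, ?_⟩
  apply tensor_hom_ext
  intro m
  simp only [LinearMap.comp_apply, LinearMap.baseChange_tmul, extProj_tprod,
    LinearMap.liftBaseChange_tmul, exteriorPower.alternatingMapLinearEquiv_apply_ιMulti, one_smul,
    tensorPowMap_one]
  rfl

lemma extProj_surjective (n : ℕ) : Function.Surjective (extProj k n M) := by
  rw [← LinearMap.range_eq_top, eq_top_iff, ← exteriorPower.ιMulti_span k n M,
    Submodule.span_le]
  rintro _ ⟨m, rfl⟩
  exact ⟨_, extProj_tprod m⟩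

end TensorPower

/-! ### Tensor products over a group algebra -/

section RelTensor

variable {k G : Type*} [Field k] [Group G] {X W : Type*} [AddCommGroup X] [Module k X]
  [AddCommGroup W] [Module k W]

/-- The tensor product `X ⊗_{kG} W` of two left `kG`-modules, where `X` is made a right `kG`-module
through `x · σ = σ⁻¹ x`: the quotient of `X ⊗_k W` by the relations `σ x ⊗ σ w = x ⊗ w`. -/
abbrev relTensor (ρ : Representation k G X) (τ : Representation k G W) : Type _ :=
  (ρ.tprod τ).Coinvariants

/-- The map `W → X ⊗_{kG} W`, `w ↦ x ⊗ w`. -/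
def relTensorIns (ρ : Representation k G X) (τ : Representation k G W) :
    X →ₗ[k] W →ₗ[k] relTensor ρ τ :=
  (TensorProduct.mk k X W).compr₂ (Representation.Coinvariants.mk (ρ.tprod τ))

lemma relTensorIns_comp (ρ : Representation k G X) (τ : Representation k G W) (σ : G) (x : X) :
    relTensorIns ρ τ (ρ σ x) ∘ₗ τ σ = relTensorIns ρ τ x := by
  ext w
  exact Representation.Coinvariants.mk_self_apply (ρ.tprod τ) σ (x ⊗ₜ w)

lemma iSup_range_relTensorIns (ρ : Representation k G X) (τ : Representation k G W) :
    ⨆ x, LinearMap.range (relTensorIns ρ τ x) = ⊤ := by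
  rw [eq_top_iff]
  rintro y -
  obtain ⟨z, rfl⟩ := Representation.Coinvariants.mk_surjective _ y
  induction z with
  | zero => simp
  | tmul x w => exact Submodule.mem_iSup_of_mem x ⟨w, rfl⟩
  | add a b ha hb => rw [map_add]; exact Submodule.add_mem _ ha hb

end RelTensor

section TensorPower

variable {k : Type*} [Field k] {A : Type*} [CommRing A] [Algebra k A]
  {M N : Type*} [AddCommGroup M] [Module k M] [AddCommGroup N] [Module k N] {n : ℕ}

lemma exists_invariantsMap (f : A ⊗[k] M →ₗ[A] A ⊗[k] N) :
    ∃ g : A ⊗[k] (permRep k n M).invariants →ₗ[A] A ⊗[k] (permRep k n N).invariants,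
      (permRep k n N).invariants.subtype.baseChange A ∘ₗ g =
        tensorPowMap n f ∘ₗ (permRep k n M).invariants.subtype.baseChange A := by
  apply exists_lift_of_range_le (Submodule.injective_subtype _)
  intro x
  apply mem_range_baseChange
  intro ξ
  rw [Submodule.range_subtype, Representation.mem_invariants]
  intro σ
  rw [← slice_baseChange]
  congr 1
  refine (LinearMap.congr_fun (permRep_comp_tensorPowMap σ f) _).trans ?_
  rw [LinearMap.comp_apply, LinearMap.comp_apply]
  congr 1
  have h2 : permRep k n M σ ∘ₗ (permRep k n M).invariants.subtype =
      (permRep k n M).invariants.subtype := by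
    ext y
    exact y.2 σ
  rw [← LinearMap.comp_apply, ← LinearMap.baseChange_comp, h2]

lemma exists_coinvariantsMap (f : A ⊗[k] M →ₗ[A] A ⊗[k] N) :
    ∃ g : A ⊗[k] (permRep k n M).Coinvariants →ₗ[A] A ⊗[k] (permRep k n N).Coinvariants,
      g ∘ₗ (Representation.Coinvariants.mk (permRep k n M)).baseChange A =
        (Representation.Coinvariants.mk (permRep k n N)).baseChange A ∘ₗ tensorPowMap n f := by
  let Φ : (⨂[k]^n M) →ₗ[k] A ⊗[k] (permRep k n N).Coinvariants :=
    (((Representation.Coinvariants.mk (permRep k n N)).baseChange A ∘ₗ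
      tensorPowMap n f).restrictScalars k) ∘ₗ TensorProduct.mk k A _ 1
  have hΦ : ∀ σ, Φ ∘ₗ permRep k n M σ = Φ := by
    intro σ
    refine LinearMap.ext fun y => ?_
    have h1 := LinearMap.congr_fun (permRep_comp_tensorPowMap σ f) (1 ⊗ₜ y)
    have h2 : Representation.Coinvariants.mk (permRep k n N) ∘ₗ permRep k n N σ =
        Representation.Coinvariants.mk (permRep k n N) := by
      refine LinearMap.ext fun y => ?_
      exact Representation.Coinvariants.mk_self_apply _ _ _
    simp only [LinearMap.comp_apply, LinearMap.baseChange_tmul] at h1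
    simp only [Φ, LinearMap.comp_apply, LinearMap.restrictScalars_apply, TensorProduct.mk_apply]
    rw [← h1, ← LinearMap.comp_apply, ← LinearMap.baseChange_comp, h2]
  refine ⟨(Representation.Coinvariants.lift _ Φ hΦ).liftBaseChange A, hom_ext_one fun y => ?_⟩
  simp [Φ]

lemma exists_relTensorMap {X : Type*} [AddCommGroup X] [Module k X]
    (ρ : Representation k (Equiv.Perm (Fin n)) X) (f : A ⊗[k] M →ₗ[A] A ⊗[k] N) :
    ∃ g : A ⊗[k] (relTensor ρ (permRep k n M)) →ₗ[A] A ⊗[k] (relTensor ρ (permRep k n N)),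
      ∀ x, g ∘ₗ (relTensorIns ρ (permRep k n M) x).baseChange A =
        (relTensorIns ρ (permRep k n N) x).baseChange A ∘ₗ tensorPowMap n f := by
  let Φ : X →ₗ[k] (⨂[k]^n M) →ₗ[k] A ⊗[k] (relTensor ρ (permRep k n N)) :=
    LinearMap.mk₂ k (fun x y => (relTensorIns ρ (permRep k n N) x).baseChange A
        (tensorPowMap n f (1 ⊗ₜ y)))
      (fun x x' y => by rw [map_add, LinearMap.baseChange_add, LinearMap.add_apply])
      (fun c x y => by rw [map_smul, LinearMap.baseChange_smul, LinearMap.smul_apply])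
      (fun x y y' => by simp only [TensorProduct.tmul_add, map_add])
      (fun c x y => by simp only [TensorProduct.tmul_smul, LinearMap.map_smul_of_tower])
  have hΦ : ∀ σ, TensorProduct.lift Φ ∘ₗ (ρ.tprod (permRep k n M)) σ = TensorProduct.lift Φ := by
    intro σ
    refine TensorProduct.ext' fun x y => ?_
    have h1 := LinearMap.congr_fun (permRep_comp_tensorPowMap σ f) (1 ⊗ₜ y)
    simp only [LinearMap.comp_apply, LinearMap.baseChange_tmul] at h1
    change (relTensorIns ρ (permRep k n N) (ρ σ x)).baseChange A
        (tensorPowMap n f (1 ⊗ₜ permRep k n M σ y)) =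
      (relTensorIns ρ (permRep k n N) x).baseChange A (tensorPowMap n f (1 ⊗ₜ y))
    rw [← h1, ← LinearMap.comp_apply, ← LinearMap.baseChange_comp, relTensorIns_comp]
  refine ⟨(Representation.Coinvariants.lift _ _ hΦ).liftBaseChange A,
    fun x => hom_ext_one fun y => ?_⟩
  simp [Φ, relTensorIns]

end TensorPower

/-! ### Frobenius twist of a vector space -/

section Twist

variable {p : ℕ} [Fact p.Prime] {k : Type*} [Field k] [CharP k p]

/-- The field `k`, regarded as a `k`-algebra through the `p ^ r`-th power map. -/
def FrobScalars (k : Type*) (_p _r : ℕ) : Type _ := k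

instance (r : ℕ) : CommRing (FrobScalars k p r) := inferInstanceAs (CommRing k)

instance (r : ℕ) : Algebra k (FrobScalars k p r) :=
  (iterateFrobenius k p r).toAlgebra

/-- The Frobenius twist `M^{(r)} = k ⊗_{φ^r} M`, where `φ` is the Frobenius of `k`: the base change
of `M` along the `p ^ r`-th power map. -/
def FrobTwist (p : ℕ) [Fact p.Prime] (k : Type*) [Field k] [CharP k p] (r : ℕ)
    (M : Type*) [AddCommGroup M] [Module k M] : Type _ :=
  FrobScalars k p r ⊗[k] M

variable {r : ℕ} {A B : Type*} [CommRing A] [Algebra k A] [CommRing B] [Algebra k B]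
  {M N P : Type*} [AddCommGroup M] [Module k M] [AddCommGroup N] [Module k N]
  [AddCommGroup P] [Module k P]

instance : AddCommGroup (FrobTwist p k r M) :=
  inferInstanceAs (AddCommGroup (FrobScalars k p r ⊗[k] M))

/-- `k` acts on `k ⊗_{φ^r} M` through the left factor. -/
instance : Module k (FrobTwist p k r M) :=
  inferInstanceAs (Module (FrobScalars k p r) (FrobScalars k p r ⊗[k] M))

instance [Module.Finite k M] : Module.Finite k (FrobTwist p k r M) :=
  inferInstanceAs (Module.Finite (FrobScalars k p r) (FrobScalars k p r ⊗[k] M))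

/-- The canonical map `M → M^{(r)}`, `m ↦ 1 ⊗ m`, semilinear over the `p ^ r`-th power map. -/
def FrobTwist.mk (p : ℕ) [Fact p.Prime] (k : Type*) [Field k] [CharP k p] (r : ℕ)
    (M : Type*) [AddCommGroup M] [Module k M] : M →+ FrobTwist p k r M where
  toFun m := (1 : FrobScalars k p r) ⊗ₜ[k] m
  map_zero' := TensorProduct.tmul_zero _ _
  map_add' := TensorProduct.tmul_add _

lemma FrobTwist.mk_smul (c : k) (m : M) :
    FrobTwist.mk p k r M (c • m) = c ^ p ^ r • FrobTwist.mk p k r M m := by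
  have h1 : (1 : FrobScalars k p r) ⊗ₜ[k] (c • m) =
    (c • (1 : FrobScalars k p r)) ⊗ₜ[k] m := (TensorProduct.smul_tmul c _ m).symm
  refine h1.trans ?_
  have h2 : c • (1 : FrobScalars k p r) = (show FrobScalars k p r from c ^ p ^ r) • 1 := by
    rw [Algebra.smul_def, mul_one, smul_eq_mul, mul_one]
    exact iterateFrobenius_def p r c
  rw [h2]
  exact (TensorProduct.smul_tmul' (show FrobScalars k p r from c ^ p ^ r) _ m).symm

lemma FrobTwist.induction {motive : FrobTwist p k r M → Prop}
    (mk : ∀ m, motive (FrobTwist.mk p k r M m)) (smul : ∀ (c : k) x, motive x → motive (c • x))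
    (add : ∀ x y, motive x → motive y → motive (x + y)) (x : FrobTwist p k r M) : motive x := by
  refine TensorProduct.induction_on (motive := motive) x ?_ ?_ add
  · have := mk 0
    rwa [map_zero] at this
  · intro c m
    have h : c ⊗ₜ[k] m = (show k from c) • FrobTwist.mk p k r M m := by
      refine Eq.trans ?_ (TensorProduct.smul_tmul' (show FrobScalars k p r from c) 1 m).symm
      rw [smul_eq_mul, mul_one]
    rw [h]
    exact smul _ _ (mk m)

/-- The underlying additive map of `FrobTwist.lift`, given by `c ⊗ m ↦ c • s m`. -/
def FrobTwist.liftAdd {Q : Type*} [AddCommGroup Q] [Module k Q] (s : M →+ Q)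
    (hs : ∀ (c : k) m, s (c • m) = c ^ p ^ r • s m) : FrobTwist p k r M →+ Q :=
  TensorProduct.liftAddHom (R := k) (M := FrobScalars k p r) (N := M)
    (((AddMonoidHom.compHom (M := M) (N := Q) (P := Q)).flip s).comp (smulAddHom k Q)) (by
    intro c a m
    have h : (c • a : FrobScalars k p r) = (c ^ p ^ r * (show k from a) : k) := by
      rw [Algebra.smul_def]
      exact congrArg (· * (show k from a)) (iterateFrobenius_def p r c)
    have h2 : (c ^ p ^ r * (show k from a) : k) • s m = (show k from a) • s (c • m) := by
      rw [hs, smul_smul, mul_comm]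
    rw [h]
    exact h2)

/-- The universal property of `M^{(r)}`. -/
def FrobTwist.lift {Q : Type*} [AddCommGroup Q] [Module k Q] (s : M →+ Q)
    (hs : ∀ (c : k) m, s (c • m) = c ^ p ^ r • s m) : FrobTwist p k r M →ₗ[k] Q where
  toFun := FrobTwist.liftAdd s hs
  map_add' := map_add _
  map_smul' c x := by
    refine TensorProduct.induction_on (motive := fun x : FrobTwist p k r M =>
      FrobTwist.liftAdd s hs (c • x) = c • FrobTwist.liftAdd s hs x) x ?_ ?_ ?_
    · refine (congrArg (FrobTwist.liftAdd s hs) (smul_zero (A := FrobTwist p k r M) c)).trans ?_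
      refine (map_zero (FrobTwist.liftAdd s hs)).trans ?_
      refine Eq.trans (smul_zero c).symm ?_
      exact congrArg (c • ·) (map_zero (FrobTwist.liftAdd s hs)).symm
    · intro a m
      exact mul_smul (α := k) c a (s m)
    · intro x y hx hy
      refine (congrArg (FrobTwist.liftAdd s hs) (smul_add (A := FrobTwist p k r M) c x y)).trans ?_
      refine (map_add (FrobTwist.liftAdd s hs) _ _).trans ?_
      rw [hx, hy, ← smul_add]
      exact congrArg (c • ·) (map_add (FrobTwist.liftAdd s hs) x y).symm

lemma FrobTwist.lift_mk {Q : Type*} [AddCommGroup Q] [Module k Q] (s : M →+ Q)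
    (hs : ∀ (c : k) m, s (c • m) = c ^ p ^ r • s m) (m : M) :
    FrobTwist.lift s hs (FrobTwist.mk p k r M m) = s m :=
  one_smul k (s m)

variable (p r) in
/-- The `p ^ r`-th power map of a commutative `k`-algebra. -/
def algFrob (k : Type*) [Field k] [CharP k p] (A : Type*) [CommRing A] [Algebra k A] : A →+ A where
  toFun a := a ^ p ^ r
  map_zero' := zero_pow (pow_ne_zero r (Fact.out : p.Prime).ne_zero)
  map_add' a b := by
    cases subsingleton_or_nontrivial A
    · exact Subsingleton.elim _ _
    · have : CharP A p := charP_of_injective_algebraMap (algebraMap k A).injective p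
      exact add_pow_char_pow a b p r

variable (p r) in
/-- The map `A ⊗ N → A ⊗ N^{(r)}`, `a ⊗ x ↦ a ^ (p ^ r) ⊗ (1 ⊗ x)`. -/
def twistMk (A : Type*) [CommRing A] [Algebra k A] (N : Type*) [AddCommGroup N] [Module k N] :
    A ⊗[k] N →+ A ⊗[k] FrobTwist p k r N :=
  TensorProduct.liftAddHom
    { toFun := fun a =>
        { toFun := fun x => (algFrob p r k A a) ⊗ₜ[k] FrobTwist.mk p k r N x
          map_zero' := by simp
          map_add' := by simp [TensorProduct.tmul_add] }
      map_zero' := by ext; simp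
      map_add' := fun a b => by ext; simp [TensorProduct.add_tmul] } (by
    intro c a x
    simp only [AddMonoidHom.coe_mk, ZeroHom.coe_mk, FrobTwist.mk_smul, TensorProduct.tmul_smul,
      TensorProduct.smul_tmul', algFrob, smul_pow])

lemma twistMk_tmul (a : A) (x : N) :
    twistMk p r A N (a ⊗ₜ x) = (a ^ p ^ r) ⊗ₜ[k] FrobTwist.mk p k r N x := rfl

lemma twistMk_smul (a : A) (x : A ⊗[k] N) :
    twistMk p r A N (a • x) = a ^ p ^ r • twistMk p r A N x := by
  induction x with
  | zero => simp
  | tmul b m => simp [TensorProduct.smul_tmul', twistMk_tmul, mul_pow]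
  | add x y hx hy => simp only [smul_add, map_add, hx, hy]

lemma scalarExt_twistMk (φ : A →ₐ[k] B) (x : A ⊗[k] N) :
    scalarExt φ _ (twistMk p r A N x) = twistMk p r B N (scalarExt φ N x) := by
  induction x with
  | zero => simp
  | tmul b m => simp [twistMk_tmul]
  | add x y hx hy => simp only [map_add, hx, hy]

variable (p r) in
/-- The Frobenius twist `A ⊗ M^{(r)} → A ⊗ N^{(r)}` of an `A`-linear map `A ⊗ M → A ⊗ N`; on
matrices it raises every entry to the power `p ^ r`. -/
def twistMap (f : A ⊗[k] M →ₗ[A] A ⊗[k] N) :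
    A ⊗[k] FrobTwist p k r M →ₗ[A] A ⊗[k] FrobTwist p k r N :=
  (FrobTwist.lift
    ((twistMk p r A N).comp (f.toAddMonoidHom.comp (TensorProduct.mk k A M 1).toAddMonoidHom))
    (by
      intro c m
      have h : f ((1 : A) ⊗ₜ[k] (c • m)) = algebraMap k A c • f (1 ⊗ₜ m) := by
        rw [TensorProduct.tmul_smul, ← algebraMap_smul A c, map_smul]
      change twistMk p r A N (f (1 ⊗ₜ (c • m))) = c ^ p ^ r • twistMk p r A N (f (1 ⊗ₜ m))
      rw [h, twistMk_smul, ← map_pow, algebraMap_smul])).liftBaseChange A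

lemma twistMap_one (f : A ⊗[k] M →ₗ[A] A ⊗[k] N) (m : M) :
    twistMap p r f (1 ⊗ₜ FrobTwist.mk p k r M m) = twistMk p r A N (f (1 ⊗ₜ m)) := by
  rw [twistMap, LinearMap.liftBaseChange_tmul, one_smul, FrobTwist.lift_mk]
  rfl

lemma twistMap_twistMk (f : A ⊗[k] M →ₗ[A] A ⊗[k] N) (x : A ⊗[k] M) :
    twistMap p r f (twistMk p r A M x) = twistMk p r A N (f x) := by
  induction x with
  | zero => simp
  | tmul b m =>
    have h1 : b ⊗ₜ[k] m = b • ((1 : A) ⊗ₜ[k] m) := by simp [TensorProduct.smul_tmul']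
    rw [h1, twistMk_smul, map_smul, map_smul, twistMk_smul, twistMk_tmul, one_pow, twistMap_one]
  | add x y hx hy => simp only [map_add, hx, hy]

lemma twist_hom_ext {Q : Type*} [AddCommGroup Q] [Module A Q]
    {f g : A ⊗[k] FrobTwist p k r M →ₗ[A] Q}
    (h : ∀ m : M, f (1 ⊗ₜ FrobTwist.mk p k r M m) = g (1 ⊗ₜ FrobTwist.mk p k r M m)) : f = g := by
  apply hom_ext_one
  intro y
  induction y using FrobTwist.induction with
  | mk m => exact h m
  | smul c x hx => rw [TensorProduct.tmul_smul, ← algebraMap_smul A c, map_smul, map_smul, hx]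
  | add x y hx hy => simp only [TensorProduct.tmul_add, map_add, hx, hy]

lemma twistMap_id : twistMap p r (LinearMap.id : A ⊗[k] M →ₗ[A] A ⊗[k] M) = LinearMap.id := by
  apply twist_hom_ext
  intro m
  simp [twistMap_one, twistMk_tmul]

lemma twistMap_comp (g : A ⊗[k] N →ₗ[A] A ⊗[k] P) (f : A ⊗[k] M →ₗ[A] A ⊗[k] N) :
    twistMap p r (g ∘ₗ f) = twistMap p r g ∘ₗ twistMap p r f := by
  apply twist_hom_ext
  intro m
  simp [twistMap_one, twistMap_twistMk]

lemma twistMap_smul (a : A) (f : A ⊗[k] M →ₗ[A] A ⊗[k] N) :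
    twistMap p r (a • f) = a ^ p ^ r • twistMap p r f := by
  apply twist_hom_ext
  intro m
  simp [twistMap_one, twistMk_smul]

lemma isExt_twistMap {φ : A →ₐ[k] B} {f : A ⊗[k] M →ₗ[A] A ⊗[k] N}
    {f' : B ⊗[k] M →ₗ[B] B ⊗[k] N} (h : IsExt φ f f') :
    IsExt φ (twistMap p r f) (twistMap p r f') := by
  apply isExt_of_one
  intro y
  induction y using FrobTwist.induction with
  | mk m => rw [twistMap_one, twistMap_one, h.one, scalarExt_twistMk]
  | smul c x hx =>
    rw [TensorProduct.tmul_smul, TensorProduct.tmul_smul, LinearMap.map_smul_of_tower,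
      LinearMap.map_smul_of_tower, hx, map_smul]
  | add x y hx hy => simp only [TensorProduct.tmul_add, map_add, hx, hy]

end Twist

/-! ### The bifunctor `Hom(V, W)` on `A`-linear maps -/

section Hom

variable {k : Type*} [Field k] {A B : Type*} [CommRing A] [Algebra k A] [CommRing B] [Algebra k B]
  {V V' V'' W W' W'' : Type*} [AddCommGroup V] [Module k V] [AddCommGroup V'] [Module k V']
  [AddCommGroup V''] [Module k V''] [AddCommGroup W] [Module k W] [AddCommGroup W'] [Module k W']
  [AddCommGroup W''] [Module k W'']

lemma homBaseChange_bijective [Module.Finite k V] :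
    Function.Bijective ((LinearMap.baseChangeHom k A V W).liftBaseChange A) := by
  have h : ∀ x, (LinearMap.baseChangeHom k A V W).liftBaseChange A x =
      LinearMap.liftBaseChangeEquiv A (lTensorHomEquivHomLTensor k V A W x) := by
    intro x
    apply hom_ext_one
    intro v
    induction x with
    | zero => simp
    | tmul a l => simp [TensorProduct.smul_tmul']
    | add x y hx hy => simp only [map_add, LinearMap.add_apply, hx, hy]
  have h2 := ((lTensorHomEquivHomLTensor k V A W).toEquiv.trans
    (LinearMap.liftBaseChangeEquiv (R := k) (M := V) (N := A ⊗[k] W) A).toEquiv).bijective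
  convert h2 using 1
  funext x
  exact h x

/-- The canonical isomorphism `A ⊗ Hom_k(V, W) ≅ Hom_A(A ⊗ V, A ⊗ W)` for finite-dimensional
`V`. -/
def homBaseChange (A : Type*) [CommRing A] [Algebra k A] (V W : Type*) [AddCommGroup V] [Module k V]
    [AddCommGroup W] [Module k W] [Module.Finite k V] :
    A ⊗[k] (V →ₗ[k] W) ≃ₗ[A] (A ⊗[k] V →ₗ[A] A ⊗[k] W) :=
  LinearEquiv.ofBijective ((LinearMap.baseChangeHom k A V W).liftBaseChange A)
    homBaseChange_bijective

lemma homBaseChange_tmul [Module.Finite k V] (a : A) (l : V →ₗ[k] W) :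
    homBaseChange A V W (a ⊗ₜ l) = a • l.baseChange A := by
  simp [homBaseChange]

lemma isExt_homBaseChange [Module.Finite k V] (φ : A →ₐ[k] B) (y : A ⊗[k] (V →ₗ[k] W)) :
    IsExt φ (homBaseChange A V W y) (homBaseChange B V W (scalarExt φ _ y)) := by
  intro x
  induction y with
  | zero => simp
  | tmul a l =>
    simp only [scalarExt_tmul, homBaseChange_tmul, LinearMap.smul_apply, scalarExt_smul,
      scalarExt_baseChange]
  | add y z hy hz => simp only [map_add, LinearMap.add_apply, hy, hz]

/-- For `f : A ⊗ V → A ⊗ V'` and `g : A ⊗ W → A ⊗ W'`, the map `h ↦ g ∘ h ∘ f`, as a map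
`A ⊗ Hom(V', W) → A ⊗ Hom(V, W')`. -/
def glMap [Module.Finite k V] [Module.Finite k V']
    (f : A ⊗[k] V →ₗ[A] A ⊗[k] V') (g : A ⊗[k] W →ₗ[A] A ⊗[k] W') :
    A ⊗[k] (V' →ₗ[k] W) →ₗ[A] A ⊗[k] (V →ₗ[k] W') :=
  (homBaseChange A V W').symm.toLinearMap ∘ₗ
    ({ toFun := fun h => g ∘ₗ h ∘ₗ f
       map_add' := fun h h' => by rw [LinearMap.add_comp, LinearMap.comp_add]
       map_smul' := fun a h => by rw [LinearMap.smul_comp, LinearMap.comp_smul]; rfl } :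
      (A ⊗[k] V' →ₗ[A] A ⊗[k] W) →ₗ[A] (A ⊗[k] V →ₗ[A] A ⊗[k] W')) ∘ₗ
    (homBaseChange A V' W).toLinearMap

variable [Module.Finite k V] [Module.Finite k V'] [Module.Finite k V'']

lemma homBaseChange_glMap (f : A ⊗[k] V →ₗ[A] A ⊗[k] V') (g : A ⊗[k] W →ₗ[A] A ⊗[k] W')
    (y : A ⊗[k] (V' →ₗ[k] W)) :
    homBaseChange A V W' (glMap f g y) = g ∘ₗ homBaseChange A V' W y ∘ₗ f := by
  simp [glMap]

lemma glMap_id : glMap (LinearMap.id : A ⊗[k] V →ₗ[A] A ⊗[k] V)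
    (LinearMap.id : A ⊗[k] W →ₗ[A] A ⊗[k] W) = LinearMap.id := by
  refine LinearMap.ext fun y => ?_
  apply (homBaseChange A V W).injective
  rw [homBaseChange_glMap]
  rfl

lemma glMap_comp (f : A ⊗[k] V →ₗ[A] A ⊗[k] V') (f' : A ⊗[k] V' →ₗ[A] A ⊗[k] V'')
    (g : A ⊗[k] W →ₗ[A] A ⊗[k] W') (g' : A ⊗[k] W' →ₗ[A] A ⊗[k] W'') :
    glMap (f' ∘ₗ f) (g' ∘ₗ g) = glMap f g' ∘ₗ glMap f' g := by
  refine LinearMap.ext fun y => ?_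
  apply (homBaseChange A V W'').injective
  rw [LinearMap.comp_apply, homBaseChange_glMap, homBaseChange_glMap, homBaseChange_glMap]
  rfl

lemma isExt_glMap {φ : A →ₐ[k] B} {f : A ⊗[k] V →ₗ[A] A ⊗[k] V'} {f' : B ⊗[k] V →ₗ[B] B ⊗[k] V'}
    {g : A ⊗[k] W →ₗ[A] A ⊗[k] W'} {g' : B ⊗[k] W →ₗ[B] B ⊗[k] W'}
    (hf : IsExt φ f f') (hg : IsExt φ g g') : IsExt φ (glMap f g) (glMap f' g') := by
  intro y
  apply (homBaseChange B V W').injective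
  rw [homBaseChange_glMap]
  refine hom_ext_one fun v => ?_
  have h1 := (isExt_homBaseChange φ (glMap f g y)).one v
  rw [h1, homBaseChange_glMap, LinearMap.comp_apply, LinearMap.comp_apply, hf.one,
    isExt_homBaseChange φ y, hg]
  rfl

lemma glMap_smul (a b : A) (f : A ⊗[k] V →ₗ[A] A ⊗[k] V') (g : A ⊗[k] W →ₗ[A] A ⊗[k] W') :
    glMap (a • f) (b • g) = (a * b) • glMap f g := by
  refine LinearMap.ext fun y => ?_
  apply (homBaseChange A V W').injective
  rw [homBaseChange_glMap, LinearMap.smul_apply, map_smul, homBaseChange_glMap, LinearMap.smul_comp,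
    LinearMap.comp_smul, LinearMap.comp_smul, smul_smul, mul_comm]

end Hom

/-! ### Strict polynomial functors -/

/-- A strict polynomial functor, homogeneous of degree `d`, over the field `k`: a finite-dimensional
space `T(V)` for each finite-dimensional `V`, and for all `V`, `W` a homogeneous polynomial map
`Hom(V, W) → Hom(T(V), T(W))` of degree `d`, compatible with identities and composition.

A polynomial map between finite-dimensional spaces `H → H'` (an element of `S^*(H^#) ⊗ H'`) is the
same as a family of maps `A ⊗ H → A ⊗ H'`, natural in the commutative `k`-algebra `A`; here
`A ⊗ Hom_k(V, W)` is written as `Hom_A(A ⊗ V, A ⊗ W)`. Homogeneity of degree `d` means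
`T(a • f) = a ^ d • T(f)` for all `a ∈ A`. -/
structure PolyFunctor (k : Type u) [Field k] (d : ℕ) where
  /-- the values of the functor -/
  obj : FGModuleCat.{u} k → FGModuleCat.{u} k
  /-- the polynomial map `Hom(V, W) → Hom(T(V), T(W))` on `A`-points -/
  map (A : Type u) [CommRing A] [Algebra k A] {V W : FGModuleCat.{u} k}
    (f : A ⊗[k] V →ₗ[A] A ⊗[k] W) : A ⊗[k] (obj V) →ₗ[A] A ⊗[k] (obj W)
  map_id (A : Type u) [CommRing A] [Algebra k A] (V : FGModuleCat.{u} k) :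
    map A (LinearMap.id : A ⊗[k] V →ₗ[A] A ⊗[k] V) = LinearMap.id
  map_comp (A : Type u) [CommRing A] [Algebra k A] {V W U : FGModuleCat.{u} k}
    (f : A ⊗[k] V →ₗ[A] A ⊗[k] W) (g : A ⊗[k] W →ₗ[A] A ⊗[k] U) :
    map A (g ∘ₗ f) = map A g ∘ₗ map A f
  /-- the polynomial map is natural in `A` -/
  map_ext {A B : Type u} [CommRing A] [Algebra k A] [CommRing B] [Algebra k B] (φ : A →ₐ[k] B)
    {V W : FGModuleCat.{u} k} (f : A ⊗[k] V →ₗ[A] A ⊗[k] W) (f' : B ⊗[k] V →ₗ[B] B ⊗[k] W) :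
    IsExt φ f f' → IsExt φ (map A f) (map B f')
  /-- the polynomial map is homogeneous of degree `d` -/
  map_smul (A : Type u) [CommRing A] [Algebra k A] {V W : FGModuleCat.{u} k} (a : A)
    (f : A ⊗[k] V →ₗ[A] A ⊗[k] W) : map A (a • f) = a ^ d • map A f

namespace PolyFunctor

variable {k : Type u} [Field k] {d e : ℕ}

/-- A morphism of strict polynomial functors: linear maps `T(V) → U(V)` compatible with the
polynomial maps (that is, on `A`-points for all `A`). -/
structure Hom (T U : PolyFunctor k d) where
  /-- the components -/
  app (V : FGModuleCat.{u} k) : T.obj V →ₗ[k] U.obj V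
  naturality (A : Type u) [CommRing A] [Algebra k A] {V W : FGModuleCat.{u} k}
    (f : A ⊗[k] V →ₗ[A] A ⊗[k] W) :
    (app W).baseChange A ∘ₗ T.map A f = U.map A f ∘ₗ (app V).baseChange A

/-- The composite functor `P ∘ Q`. -/
def comp (P : PolyFunctor k d) (Q : PolyFunctor k e) : PolyFunctor k (d * e) where
  obj V := P.obj (Q.obj V)
  map A _ _ _ _ f := P.map A (Q.map A f)
  map_id A _ _ V := by rw [Q.map_id, P.map_id]
  map_comp A _ _ _ _ _ f g := by rw [Q.map_comp, P.map_comp]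
  map_ext φ _ _ _ _ h := P.map_ext φ _ _ (Q.map_ext φ _ _ h)
  map_smul A _ _ _ _ _ _ := by rw [Q.map_smul, P.map_smul, ← pow_mul, mul_comm e d]

/-- The morphism `T ∘ Q → U ∘ Q` induced by a morphism `T → U`. -/
def Hom.whisker {T U : PolyFunctor k d} (η : Hom T U) (Q : PolyFunctor k e) :
    Hom (T.comp Q) (U.comp Q) where
  app V := η.app (Q.obj V)
  naturality A _ _ _ _ f := η.naturality A (Q.map A f)

/-- The tensor power functor `⊗^n`. -/
def tensorPow (k : Type u) [Field k] (n : ℕ) : PolyFunctor k n where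
  obj V := FGModuleCat.of k (⨂[k]^n V)
  map _ _ _ _ _ f := tensorPowMap n f
  map_id _ _ _ _ := tensorPowMap_id
  map_comp _ _ _ _ _ _ f g := tensorPowMap_comp g f
  map_ext _ _ _ _ _ h := isExt_tensorPowMap h
  map_smul _ _ _ _ _ a f := tensorPowMap_smul a f

/-- The Frobenius twist functor `I^{(r)}`. -/
def frob (p : ℕ) [Fact p.Prime] (k : Type u) [Field k] [CharP k p] (r : ℕ) :
    PolyFunctor k (p ^ r) where
  obj V := FGModuleCat.of k (FrobTwist p k r V)
  map _ _ _ _ _ f := twistMap p r f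
  map_id _ _ _ _ := twistMap_id
  map_comp _ _ _ _ _ _ f g := twistMap_comp g f
  map_ext _ _ _ _ _ h := isExt_twistMap h
  map_smul _ _ _ _ _ a f := twistMap_smul a f

/-- The subfunctor of `P` with given spaces `Q(V)` and inclusions `ι : Q(V) → P(V)`, provided that
the maps `P(f)` restrict. -/
def ofSub (P : PolyFunctor k d) (Q : FGModuleCat.{u} k → FGModuleCat.{u} k)
    (ι : ∀ V, Q V →ₗ[k] P.obj V) (hι : ∀ V, Function.Injective (ι V))
    (h : ∀ (A : Type u) [CommRing A] [Algebra k A] (V W : FGModuleCat.{u} k)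
      (f : A ⊗[k] V →ₗ[A] A ⊗[k] W), ∃ g : A ⊗[k] (Q V) →ₗ[A] A ⊗[k] (Q W),
        (ι W).baseChange A ∘ₗ g = P.map A f ∘ₗ (ι V).baseChange A) : PolyFunctor k d where
  obj := Q
  map A _ _ V W f := Classical.choose (h A V W f)
  map_id A _ _ V := by
    rw [← LinearMap.cancel_left (baseChange_injective (hι V)), Classical.choose_spec (h A V V _),
      P.map_id]
    rfl
  map_comp A _ _ V W U f g := by
    rw [← LinearMap.cancel_left (baseChange_injective (hι U)), Classical.choose_spec (h A V U _),
      P.map_comp, ← LinearMap.comp_assoc, Classical.choose_spec (h A W U g), LinearMap.comp_assoc,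
      LinearMap.comp_assoc, Classical.choose_spec (h A V W f)]
  map_ext {A B} _ _ _ _ φ V W f f' hf x := by
    apply baseChange_injective (A := B) (hι W)
    have h1 := fun y => LinearMap.congr_fun (Classical.choose_spec (h A V W f)) y
    have h2 := fun y => LinearMap.congr_fun (Classical.choose_spec (h B V W f')) y
    simp only [LinearMap.comp_apply] at h1 h2
    rw [h2, ← scalarExt_baseChange, ← scalarExt_baseChange, h1]
    exact P.map_ext φ f f' hf _
  map_smul A _ _ V W a f := by
    rw [← LinearMap.cancel_left (baseChange_injective (hι W)), Classical.choose_spec (h A V W _),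
      P.map_smul, LinearMap.comp_smul, LinearMap.smul_comp, Classical.choose_spec (h A V W f)]

/-- The quotient functor of a direct sum of copies of `P` with given spaces `Q(V)` and linear maps
`π x : P(V) → Q(V)`, `x ∈ X`, whose images together span `Q(V)`, provided that the maps `P(f)`
descend. -/
def ofQuot (P : PolyFunctor k d) (Q : FGModuleCat.{u} k → FGModuleCat.{u} k) {X : Type*}
    (π : X → ∀ V, P.obj V →ₗ[k] Q V) (hπ : ∀ V, ⨆ x, LinearMap.range (π x V) = ⊤)
    (h : ∀ (A : Type u) [CommRing A] [Algebra k A] (V W : FGModuleCat.{u} k)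
      (f : A ⊗[k] V →ₗ[A] A ⊗[k] W), ∃ g : A ⊗[k] (Q V) →ₗ[A] A ⊗[k] (Q W),
        ∀ x, g ∘ₗ (π x V).baseChange A = (π x W).baseChange A ∘ₗ P.map A f) : PolyFunctor k d :=
  have key : ∀ (A : Type u) [CommRing A] [Algebra k A] (V : FGModuleCat.{u} k)
      (N : Type u) [AddCommGroup N] [Module A N] (g g' : A ⊗[k] (Q V) →ₗ[A] N),
      (∀ x, g ∘ₗ (π x V).baseChange A = g' ∘ₗ (π x V).baseChange A) → g = g' := by
    intro A _ _ V N _ _ g g' hg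
    apply hom_ext_one
    intro q
    have hq : q ∈ ⨆ x, LinearMap.range (π x V) := by rw [hπ]; trivial
    induction hq using Submodule.iSup_induction' with
    | mem x q hq =>
      obtain ⟨y, rfl⟩ := hq
      simpa using LinearMap.congr_fun (hg x) (1 ⊗ₜ y)
    | zero => simp
    | add a b _ _ ha hb => simp only [TensorProduct.tmul_add, map_add, ha, hb]
  { obj := Q
    map A _ _ V W f := Classical.choose (h A V W f)
    map_id A _ _ V := by
      apply key
      intro x
      rw [Classical.choose_spec (h A V V _), P.map_id]
      rfl
    map_comp A _ _ V W U f g := by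
      apply key
      intro x
      rw [Classical.choose_spec (h A V U _), LinearMap.comp_assoc,
        Classical.choose_spec (h A V W f), ← LinearMap.comp_assoc,
        Classical.choose_spec (h A W U g), P.map_comp, LinearMap.comp_assoc]
    map_ext {A B} _ _ _ _ φ V W f f' hf := by
      apply isExt_of_one
      intro q
      have hq : q ∈ ⨆ x, LinearMap.range (π x V) := by rw [hπ]; trivial
      induction hq using Submodule.iSup_induction' with
      | mem x q hq =>
        obtain ⟨y, rfl⟩ := hq
        have h1 := LinearMap.congr_fun (Classical.choose_spec (h A V W f) x) (1 ⊗ₜ y)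
        have h2 := LinearMap.congr_fun (Classical.choose_spec (h B V W f') x) (1 ⊗ₜ y)
        simp only [LinearMap.comp_apply, LinearMap.baseChange_tmul] at h1 h2
        rw [h1, h2, (P.map_ext φ f f' hf).one, scalarExt_baseChange]
      | zero => simp
      | add a b _ _ ha hb => simp only [TensorProduct.tmul_add, map_add, ha, hb]
    map_smul A _ _ V W a f := by
      apply key
      intro x
      rw [Classical.choose_spec (h A V W _), P.map_smul, LinearMap.comp_smul, LinearMap.smul_comp,
        Classical.choose_spec (h A V W f)] }

/-- The projection onto a quotient functor. -/
def ofQuotProj (P : PolyFunctor k d) (Q : FGModuleCat.{u} k → FGModuleCat.{u} k) {X : Type*}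
    (π : X → ∀ V, P.obj V →ₗ[k] Q V) (hπ : ∀ V, ⨆ x, LinearMap.range (π x V) = ⊤)
    (h : ∀ (A : Type u) [CommRing A] [Algebra k A] (V W : FGModuleCat.{u} k)
      (f : A ⊗[k] V →ₗ[A] A ⊗[k] W), ∃ g : A ⊗[k] (Q V) →ₗ[A] A ⊗[k] (Q W),
        ∀ x, g ∘ₗ (π x V).baseChange A = (π x W).baseChange A ∘ₗ P.map A f) (x : X) :
    Hom P (P.ofQuot Q π hπ h) where
  app V := π x V
  naturality A _ _ V W f := (Classical.choose_spec (h A V W f) x).symm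

/-- The action of a permutation on `⊗^n`. -/
def permHom (k : Type u) [Field k] {n : ℕ} (σ : Equiv.Perm (Fin n)) :
    Hom (tensorPow k n) (tensorPow k n) where
  app V := permRep k n V σ
  naturality _ _ _ _ _ f := permRep_comp_tensorPowMap σ f

/-- The divided power functor `Γ^n`: `Γ^n(V)` is the space of `𝔖_n`-invariants of `V^{⊗ n}`. -/
def dividedPow (k : Type u) [Field k] (n : ℕ) : PolyFunctor k n :=
  (tensorPow k n).ofSub (fun V => FGModuleCat.of k (permRep k n V).invariants)
    (fun V => (permRep k n V).invariants.subtype) (fun _ => Subtype.val_injective)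
    (fun _ _ _ _ _ f => exists_invariantsMap f)

lemma iSup_range_eq_top {M N : Type*} [AddCommGroup M] [Module k M] [AddCommGroup N] [Module k N]
    (f : M →ₗ[k] N) (hf : Function.Surjective f) :
    ⨆ _ : Unit, LinearMap.range f = ⊤ := by
  rw [iSup_const, LinearMap.range_eq_top.mpr hf]

/-- The symmetric power functor `S^n`: `S^n(V)` is the space of `𝔖_n`-coinvariants of
`V^{⊗ n}`. -/
def symPow (k : Type u) [Field k] (n : ℕ) : PolyFunctor k n :=
  (tensorPow k n).ofQuot (fun V => FGModuleCat.of k (permRep k n V).Coinvariants) (X := Unit)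
    (fun _ V => Representation.Coinvariants.mk (permRep k n V))
    (fun V => iSup_range_eq_top (Representation.Coinvariants.mk (permRep k n V))
      (Representation.Coinvariants.mk_surjective _))
    (fun _ _ _ _ _ f => (exists_coinvariantsMap f).imp fun _ h _ => h)

/-- The projection `⊗^n → S^n`. -/
def symProj (k : Type u) [Field k] (n : ℕ) : Hom (tensorPow k n) (symPow k n) :=
  ofQuotProj _ _ _ _ _ ()

/-- The exterior power functor `Λ^n`. -/
def extPow (k : Type u) [Field k] (n : ℕ) : PolyFunctor k n :=
  (tensorPow k n).ofQuot (fun V => FGModuleCat.of k (⋀[k]^n V)) (X := Unit)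
    (fun _ V => StrictPoly.extProj k n V)
    (fun V => iSup_range_eq_top (StrictPoly.extProj k n V) (extProj_surjective n))
    (fun _ _ _ _ _ f => (exists_extPowMap f).imp fun _ h _ => h)

/-- The projection `⊗^n → Λ^n`. -/
def extProj (k : Type u) [Field k] (n : ℕ) : Hom (tensorPow k n) (extPow k n) :=
  ofQuotProj _ _ _ _ _ ()

/-- The functor `V ↦ X ⊗_{k𝔖_n} V^{⊗ n}`, for a finite-dimensional representation `X` of
`𝔖_n`. -/
def relTensorPow {n : ℕ} {X : Type u} [AddCommGroup X] [Module k X] [Module.Finite k X]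
    (ρ : Representation k (Equiv.Perm (Fin n)) X) : PolyFunctor k n :=
  (tensorPow k n).ofQuot (fun V => FGModuleCat.of k (relTensor ρ (permRep k n V)))
    (fun x V => relTensorIns ρ (permRep k n V) x)
    (fun V => iSup_range_relTensorIns ρ (permRep k n V))
    (fun _ _ _ _ _ f => exists_relTensorMap ρ f)

/-- The morphism `⊗^n → X ⊗_{k𝔖_n} ⊗^n`, `t ↦ x ⊗ t`, for `x ∈ X`. -/
def relTensorPowIns {n : ℕ} {X : Type u} [AddCommGroup X] [Module k X] [Module.Finite k X]
    (ρ : Representation k (Equiv.Perm (Fin n)) X) (x : X) :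
    Hom (tensorPow k n) (relTensorPow ρ) :=
  ofQuotProj _ _ _ _ _ x

end PolyFunctor

/-! ### Strict polynomial bifunctors -/

/-- A strict polynomial bifunctor of bounded degree, contravariant in the first variable and
covariant in the second: finite-dimensional spaces `T(V, W)`, and polynomial maps
`Hom(V, V') × Hom(W, W') → Hom(T(V', W), T(V, W'))`, compatible with identities and composition,
of bounded degree. As for `PolyFunctor`, a polynomial map is given by its values on `A`-points for
all commutative `k`-algebras `A`, and `A ⊗ Hom_k(V, W)` is written as `Hom_A(A ⊗ V, A ⊗ W)`. -/
structure PolyBifunctor (k : Type u) [Field k] where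
  /-- the values of the bifunctor -/
  obj : FGModuleCat.{u} k → FGModuleCat.{u} k → FGModuleCat.{u} k
  /-- the polynomial map `Hom(V, V') × Hom(W, W') → Hom(T(V', W), T(V, W'))` on `A`-points -/
  map (A : Type u) [CommRing A] [Algebra k A] {V V' W W' : FGModuleCat.{u} k}
    (f : A ⊗[k] V →ₗ[A] A ⊗[k] V') (g : A ⊗[k] W →ₗ[A] A ⊗[k] W') :
    A ⊗[k] (obj V' W) →ₗ[A] A ⊗[k] (obj V W')
  map_id (A : Type u) [CommRing A] [Algebra k A] (V W : FGModuleCat.{u} k) :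
    map A (LinearMap.id : A ⊗[k] V →ₗ[A] A ⊗[k] V) (LinearMap.id : A ⊗[k] W →ₗ[A] A ⊗[k] W) =
      LinearMap.id
  map_comp (A : Type u) [CommRing A] [Algebra k A] {V V' V'' W W' W'' : FGModuleCat.{u} k}
    (f : A ⊗[k] V →ₗ[A] A ⊗[k] V') (f' : A ⊗[k] V' →ₗ[A] A ⊗[k] V'')
    (g : A ⊗[k] W →ₗ[A] A ⊗[k] W') (g' : A ⊗[k] W' →ₗ[A] A ⊗[k] W'') :
    map A (f' ∘ₗ f) (g' ∘ₗ g) = map A f g' ∘ₗ map A f' g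
  /-- the polynomial map is natural in `A` -/
  map_ext {A B : Type u} [CommRing A] [Algebra k A] [CommRing B] [Algebra k B] (φ : A →ₐ[k] B)
    {V V' W W' : FGModuleCat.{u} k}
    (f : A ⊗[k] V →ₗ[A] A ⊗[k] V') (f' : B ⊗[k] V →ₗ[B] B ⊗[k] V')
    (g : A ⊗[k] W →ₗ[A] A ⊗[k] W') (g' : B ⊗[k] W →ₗ[B] B ⊗[k] W') :
    IsExt φ f f' → IsExt φ g g' → IsExt φ (map A f g) (map B f' g')
  /-- there is an integer `N` bounding the degrees of all the polynomial maps: over the polynomial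
  ring `A[X]`, the coefficient of `X ^ i` in `T(X • f, X • g)` vanishes for `i > N` -/
  bounded : ∃ N : ℕ, ∀ (A : Type u) [CommRing A] [Algebra k A] (V V' W W' : FGModuleCat.{u} k)
    (f : A ⊗[k] V →ₗ[A] A ⊗[k] V') (g : A ⊗[k] W →ₗ[A] A ⊗[k] W')
    (f' : Polynomial A ⊗[k] V →ₗ[Polynomial A] Polynomial A ⊗[k] V')
    (g' : Polynomial A ⊗[k] W →ₗ[Polynomial A] Polynomial A ⊗[k] W'),
    IsExt Polynomial.CAlgHom f f' → IsExt Polynomial.CAlgHom g g' →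
    ∀ (t : obj V' W) (i : ℕ), N < i →
      ((Polynomial.lcoeff A i).restrictScalars k).rTensor (obj V W')
        (map (Polynomial A) ((Polynomial.X : Polynomial A) • f')
          ((Polynomial.X : Polynomial A) • g') (1 ⊗ₜ t)) = 0

lemma lcoeff_X_pow_smul {k A M : Type*} [Field k] [CommRing A] [Algebra k A] [AddCommGroup M]
    [Module k M] (i m : ℕ) (y : A ⊗[k] M) (h : i ≠ m) :
    ((Polynomial.lcoeff A i).restrictScalars k).rTensor M
      ((Polynomial.X : Polynomial A) ^ m • scalarExt Polynomial.CAlgHom M y) = 0 := by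
  induction y with
  | zero => simp
  | tmul a x =>
    simp [TensorProduct.smul_tmul', mul_comm _ (Polynomial.C a), Polynomial.coeff_C_mul,
      Polynomial.coeff_X_pow, h]
  | add x y hx hy => simp only [map_add, smul_add, hx, hy, add_zero]

lemma lcoeff_baseChange {k A M N : Type*} [Field k] [CommRing A] [Algebra k A] [AddCommGroup M]
    [Module k M] [AddCommGroup N] [Module k N] (i : ℕ) (l : M →ₗ[k] N)
    (y : Polynomial A ⊗[k] M) :
    ((Polynomial.lcoeff A i).restrictScalars k).rTensor N (l.baseChange (Polynomial A) y) =
      l.baseChange A (((Polynomial.lcoeff A i).restrictScalars k).rTensor M y) := by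
  induction y with
  | zero => simp
  | tmul a x => simp
  | add x y hx hy => simp only [map_add, hx, hy]

/-- The bifunctor `P ∘ gl`, where `gl(V, W) = Hom_k(V, W)`. -/
def PolyFunctor.compGL {k : Type u} [Field k] {d : ℕ} (P : PolyFunctor k d) :
    PolyBifunctor k where
  obj V W := P.obj (FGModuleCat.of k (V →ₗ[k] W))
  map A _ _ V V' W W' f g := P.map A (V := FGModuleCat.of k (V' →ₗ[k] W))
    (W := FGModuleCat.of k (V →ₗ[k] W')) (glMap f g)
  map_id A _ _ V W := by
    rw [glMap_id]
    exact P.map_id A (FGModuleCat.of k (V →ₗ[k] W))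
  map_comp A _ _ V V' V'' W W' W'' f f' g g' := by
    rw [glMap_comp]
    exact P.map_comp A (V := FGModuleCat.of k (V'' →ₗ[k] W))
      (W := FGModuleCat.of k (V' →ₗ[k] W')) (U := FGModuleCat.of k (V →ₗ[k] W'')) _ _
  map_ext φ V V' W W' f f' g g' hf hg :=
    P.map_ext φ (V := FGModuleCat.of k (V' →ₗ[k] W)) (W := FGModuleCat.of k (V →ₗ[k] W')) _ _
      (isExt_glMap hf hg)
  bounded := by
    refine ⟨2 * d, ?_⟩
    intro A _ _ V V' W W' f g f' g' hf hg t i hi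
    have h1 := P.map_ext Polynomial.CAlgHom (V := FGModuleCat.of k (V' →ₗ[k] W))
      (W := FGModuleCat.of k (V →ₗ[k] W')) _ _ (isExt_glMap hf hg)
    rw [glMap_smul, P.map_smul, LinearMap.smul_apply, h1.one, ← pow_two, ← pow_mul]
    exact lcoeff_X_pow_smul i (2 * d) _ hi.ne'

namespace PolyBifunctor

variable {k : Type u} [Field k]

/-- A morphism of strict polynomial bifunctors: linear maps `T(V, W) → U(V, W)` compatible with the
polynomial maps (that is, on `A`-points for all `A`). -/
@[ext]
structure Hom (T U : PolyBifunctor k) where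
  /-- the components -/
  app (V W : FGModuleCat.{u} k) : T.obj V W →ₗ[k] U.obj V W
  naturality (A : Type u) [CommRing A] [Algebra k A] {V V' W W' : FGModuleCat.{u} k}
    (f : A ⊗[k] V →ₗ[A] A ⊗[k] V') (g : A ⊗[k] W →ₗ[A] A ⊗[k] W') :
    (app V W').baseChange A ∘ₗ T.map A f g = U.map A f g ∘ₗ (app V' W).baseChange A

/-- The category of strict polynomial bifunctors of bounded degree. -/
instance : Category (PolyBifunctor k) where
  Hom := Hom
  id T :=
    { app := fun _ _ => LinearMap.id
      naturality := fun A _ _ V V' W W' f g => by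
        rw [LinearMap.baseChange_id, LinearMap.baseChange_id]; rfl }
  comp η θ :=
    { app := fun V W => θ.app V W ∘ₗ η.app V W
      naturality := fun A _ _ V V' W W' f g => by
        rw [LinearMap.baseChange_comp, LinearMap.baseChange_comp, LinearMap.comp_assoc,
          η.naturality, ← LinearMap.comp_assoc, θ.naturality, LinearMap.comp_assoc] }

variable {T U S : PolyBifunctor k}

@[ext] lemma hom_ext {η θ : T ⟶ U} (h : ∀ V W, η.app V W = θ.app V W) : η = θ :=
  Hom.ext (funext fun V => funext fun W => h V W)

@[simp] lemma id_app (V W : FGModuleCat.{u} k) : Hom.app (𝟙 T) V W = LinearMap.id := rfl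

@[simp] lemma comp_app (η : T ⟶ U) (θ : U ⟶ S) (V W : FGModuleCat.{u} k) :
    Hom.app (η ≫ θ) V W = θ.app V W ∘ₗ η.app V W := rfl

instance : Zero (T ⟶ U) :=
  ⟨{ app := fun _ _ => 0
     naturality := fun A _ _ V V' W W' f g => by simp }⟩

instance : Add (T ⟶ U) :=
  ⟨fun η θ =>
   { app := fun V W => η.app V W + θ.app V W
     naturality := fun A _ _ V V' W W' f g => by
      simp only [LinearMap.baseChange_add, LinearMap.add_comp, LinearMap.comp_add, η.naturality,
        θ.naturality] }⟩

instance : Neg (T ⟶ U) :=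
  ⟨fun η =>
   { app := fun V W => -η.app V W
     naturality := fun A _ _ V V' W W' f g => by
      simp only [LinearMap.baseChange_neg, LinearMap.neg_comp, LinearMap.comp_neg,
        η.naturality] }⟩

instance : SMul k (T ⟶ U) :=
  ⟨fun c η =>
   { app := fun V W => c • η.app V W
     naturality := fun A _ _ V V' W W' f g => by
      rw [LinearMap.baseChange_smul, LinearMap.baseChange_smul]
      refine LinearMap.ext fun x => ?_
      have h := LinearMap.congr_fun (η.naturality A f g) x
      simp only [LinearMap.comp_apply, LinearMap.smul_apply, LinearMap.map_smul_of_tower] at h ⊢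
      rw [h] }⟩

@[simp] lemma zero_app (V W : FGModuleCat.{u} k) : Hom.app (0 : T ⟶ U) V W = 0 := rfl

@[simp] lemma add_app (η θ : T ⟶ U) (V W : FGModuleCat.{u} k) :
    Hom.app (η + θ) V W = η.app V W + θ.app V W := rfl

@[simp] lemma neg_app (η : T ⟶ U) (V W : FGModuleCat.{u} k) :
    Hom.app (-η) V W = -η.app V W := rfl

@[simp] lemma smul_app (c : k) (η : T ⟶ U) (V W : FGModuleCat.{u} k) :
    Hom.app (c • η) V W = c • η.app V W := rfl

instance : AddCommGroup (T ⟶ U) where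
  add_assoc _ _ _ := by ext : 2; simp [add_assoc]
  zero_add _ := by ext : 2; simp
  add_zero _ := by ext : 2; simp
  add_comm _ _ := by ext : 2; simp [add_comm]
  neg_add_cancel _ := by ext : 2; simp
  nsmul := nsmulRec
  zsmul := zsmulRec

instance : Preadditive (PolyBifunctor k) where
  add_comp _ _ _ _ _ _ := by ext : 2; simp [LinearMap.comp_add]
  comp_add _ _ _ _ _ _ := by ext : 2; simp [LinearMap.add_comp]

instance : Linear k (PolyBifunctor k) where
  homModule T U :=
    { one_smul := fun _ => by ext : 2; simp
      mul_smul := fun _ _ _ => by ext : 2; simp [mul_smul]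
      smul_zero := fun _ => by ext : 2; simp
      smul_add := fun _ _ _ => by ext : 2; simp
      add_smul := fun _ _ _ => by ext : 2; simp [add_smul]
      zero_smul := fun _ => by ext : 2; simp }
  smul_comp _ _ _ _ _ _ := by ext : 2; simp [LinearMap.comp_smul]
  comp_smul _ _ _ _ _ _ := by ext : 2; simp [LinearMap.smul_comp]

/-! #### Kernels -/

lemma exists_kerMap (η : T ⟶ U) (A : Type u) [CommRing A] [Algebra k A]
    {V V' W W' : FGModuleCat.{u} k}
    (f : A ⊗[k] V →ₗ[A] A ⊗[k] V') (g : A ⊗[k] W →ₗ[A] A ⊗[k] W') :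
    ∃ h : A ⊗[k] (LinearMap.ker (η.app V' W)) →ₗ[A] A ⊗[k] (LinearMap.ker (η.app V W')),
      (LinearMap.ker (η.app V W')).subtype.baseChange A ∘ₗ h =
        T.map A f g ∘ₗ (LinearMap.ker (η.app V' W)).subtype.baseChange A := by
  apply exists_lift_of_range_le (Submodule.injective_subtype _)
  intro x
  apply mem_range_baseChange
  intro ξ
  rw [Submodule.range_subtype, LinearMap.mem_ker, ← slice_baseChange]
  have h1 := LinearMap.congr_fun (η.naturality A f g)
    ((LinearMap.ker (η.app V' W)).subtype.baseChange A x)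
  have h2 : (η.app V' W).baseChange A ((LinearMap.ker (η.app V' W)).subtype.baseChange A x) = 0 := by
    rw [← LinearMap.comp_apply, ← LinearMap.baseChange_comp, LinearMap.comp_ker_subtype]
    simp
  rw [LinearMap.comp_apply, LinearMap.comp_apply, h2, map_zero] at h1
  rw [LinearMap.comp_apply, h1, map_zero]

/-- The kernel of a morphism, computed objectwise. -/
def ker (η : T ⟶ U) : PolyBifunctor k where
  obj V W := FGModuleCat.of k (LinearMap.ker (η.app V W))
  map A _ _ _ _ _ _ f g := Classical.choose (exists_kerMap η A f g)
  map_id A _ _ V W := by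
    rw [← LinearMap.cancel_left (baseChange_injective (Submodule.injective_subtype _)),
      Classical.choose_spec (exists_kerMap η A _ _), T.map_id]
    rfl
  map_comp A _ _ V V' V'' W W' W'' f f' g g' := by
    rw [← LinearMap.cancel_left (baseChange_injective (Submodule.injective_subtype _)),
      Classical.choose_spec (exists_kerMap η A _ _), T.map_comp, ← LinearMap.comp_assoc,
      Classical.choose_spec (exists_kerMap η A f g'), LinearMap.comp_assoc, LinearMap.comp_assoc,
      Classical.choose_spec (exists_kerMap η A f' g)]
  map_ext {A B} _ _ _ _ φ V V' W W' f f' g g' hf hg x := by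
    apply baseChange_injective (A := B) (Submodule.injective_subtype (LinearMap.ker (η.app V W')))
    have h1 := fun y => LinearMap.congr_fun (Classical.choose_spec (exists_kerMap η A f g)) y
    have h2 := fun y => LinearMap.congr_fun (Classical.choose_spec (exists_kerMap η B f' g')) y
    simp only [LinearMap.comp_apply] at h1 h2
    refine (h2 _).trans ?_
    rw [← scalarExt_baseChange, ← scalarExt_baseChange]
    refine Eq.trans ?_ (congrArg (scalarExt φ _) (h1 _)).symm
    exact T.map_ext φ f f' g g' hf hg _
  bounded := by
    obtain ⟨N, hN⟩ := T.bounded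
    refine ⟨N, fun A _ _ V V' W W' f g f' g' hf hg t i hi => ?_⟩
    apply baseChange_injective (A := A) (Submodule.injective_subtype (LinearMap.ker (η.app V W')))
    rw [map_zero]
    refine (lcoeff_baseChange i _ _).symm.trans ?_
    have h1 := LinearMap.congr_fun (Classical.choose_spec (exists_kerMap η (Polynomial A)
      ((Polynomial.X : Polynomial A) • f') ((Polynomial.X : Polynomial A) • g')))
      ((1 : Polynomial A) ⊗ₜ t)
    simp only [LinearMap.comp_apply, LinearMap.baseChange_tmul] at h1
    refine (congrArg _ h1).trans ?_
    exact hN A V V' W W' f g f' g' hf hg t.1 i hi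

/-- The inclusion of the kernel. -/
def kerι (η : T ⟶ U) : ker η ⟶ T where
  app V W := (LinearMap.ker (η.app V W)).subtype
  naturality A _ _ _ _ _ _ f g := Classical.choose_spec (exists_kerMap η A f g)

/-! #### Cokernels -/

lemma exists_cokerMap (η : T ⟶ U) (A : Type u) [CommRing A] [Algebra k A]
    {V V' W W' : FGModuleCat.{u} k}
    (f : A ⊗[k] V →ₗ[A] A ⊗[k] V') (g : A ⊗[k] W →ₗ[A] A ⊗[k] W') :
    ∃ h : A ⊗[k] (U.obj V' W ⧸ LinearMap.range (η.app V' W)) →ₗ[A]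
        A ⊗[k] (U.obj V W' ⧸ LinearMap.range (η.app V W')),
      h ∘ₗ (LinearMap.range (η.app V' W)).mkQ.baseChange A =
        (LinearMap.range (η.app V W')).mkQ.baseChange A ∘ₗ U.map A f g := by
  let Φ : U.obj V' W →ₗ[k] A ⊗[k] (U.obj V W' ⧸ LinearMap.range (η.app V W')) :=
    (((LinearMap.range (η.app V W')).mkQ.baseChange A ∘ₗ U.map A f g).restrictScalars k) ∘ₗ
      TensorProduct.mk k A _ 1
  have hΦ : LinearMap.range (η.app V' W) ≤ LinearMap.ker Φ := by
    rintro _ ⟨t, rfl⟩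
    have h1 := LinearMap.congr_fun (η.naturality A f g) (1 ⊗ₜ t)
    simp only [LinearMap.comp_apply, LinearMap.baseChange_tmul] at h1
    simp only [Φ, LinearMap.mem_ker, LinearMap.comp_apply, LinearMap.restrictScalars_apply,
      TensorProduct.mk_apply]
    rw [← h1, ← LinearMap.comp_apply, ← LinearMap.baseChange_comp, LinearMap.range_mkQ_comp]
    simp
  refine ⟨((LinearMap.range (η.app V' W)).liftQ Φ hΦ).liftBaseChange A, hom_ext_one fun y => ?_⟩
  simp [Φ]

/-- The maps induced on cokernels. -/
def cokerMap (η : T ⟶ U) (A : Type u) [CommRing A] [Algebra k A]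
    {V V' W W' : FGModuleCat.{u} k}
    (f : A ⊗[k] V →ₗ[A] A ⊗[k] V') (g : A ⊗[k] W →ₗ[A] A ⊗[k] W') :
    A ⊗[k] (U.obj V' W ⧸ LinearMap.range (η.app V' W)) →ₗ[A]
        A ⊗[k] (U.obj V W' ⧸ LinearMap.range (η.app V W')) :=
  Classical.choose (exists_cokerMap η A f g)

lemma cokerMap_spec (η : T ⟶ U) (A : Type u) [CommRing A] [Algebra k A]
    {V V' W W' : FGModuleCat.{u} k}
    (f : A ⊗[k] V →ₗ[A] A ⊗[k] V') (g : A ⊗[k] W →ₗ[A] A ⊗[k] W') (y : A ⊗[k] (U.obj V' W)) :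
    cokerMap η A f g ((LinearMap.range (η.app V' W)).mkQ.baseChange A y) =
      (LinearMap.range (η.app V W')).mkQ.baseChange A (U.map A f g y) :=
  LinearMap.congr_fun (Classical.choose_spec (exists_cokerMap η A f g)) y

lemma cokerMap_one (η : T ⟶ U) (A : Type u) [CommRing A] [Algebra k A]
    {V V' W W' : FGModuleCat.{u} k}
    (f : A ⊗[k] V →ₗ[A] A ⊗[k] V') (g : A ⊗[k] W →ₗ[A] A ⊗[k] W') (y : U.obj V' W) :
    cokerMap η A f g (1 ⊗ₜ (LinearMap.range (η.app V' W)).mkQ y) =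
      (LinearMap.range (η.app V W')).mkQ.baseChange A (U.map A f g (1 ⊗ₜ y)) :=
  cokerMap_spec η A f g (1 ⊗ₜ y)

/-- The cokernel of a morphism, computed objectwise. -/
def coker (η : T ⟶ U) : PolyBifunctor k where
  obj V W := FGModuleCat.of k (U.obj V W ⧸ LinearMap.range (η.app V W))
  map A _ _ _ _ _ _ f g := cokerMap η A f g
  map_id A _ _ V W := by
    refine hom_ext_one fun y => ?_
    obtain ⟨y, rfl⟩ := Submodule.mkQ_surjective _ y
    rw [cokerMap_one, U.map_id]
    rfl
  map_comp A _ _ V V' V'' W W' W'' f f' g g' := by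
    refine hom_ext_one fun y => ?_
    obtain ⟨y, rfl⟩ := Submodule.mkQ_surjective _ y
    rw [cokerMap_one, LinearMap.comp_apply, cokerMap_one, cokerMap_spec, U.map_comp]
    rfl
  map_ext {A B} _ _ _ _ φ V V' W W' f f' g g' hf hg := by
    apply isExt_of_one
    intro y
    obtain ⟨y, rfl⟩ := Submodule.mkQ_surjective _ y
    rw [cokerMap_one, cokerMap_one, (U.map_ext φ f f' g g' hf hg).one]
    exact (scalarExt_baseChange φ _ _).symm
  bounded := by
    obtain ⟨N, hN⟩ := U.bounded
    refine ⟨N, fun A _ _ V V' W W' f g f' g' hf hg t i hi => ?_⟩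
    obtain ⟨t, rfl⟩ := Submodule.mkQ_surjective _ t
    rw [cokerMap_one]
    refine (lcoeff_baseChange i _ _).trans ?_
    rw [hN A V V' W W' f g f' g' hf hg t i hi, map_zero]

/-- The projection onto the cokernel. -/
def cokerπ (η : T ⟶ U) : U ⟶ coker η where
  app V W := (LinearMap.range (η.app V W)).mkQ
  naturality A _ _ _ _ _ _ f g := LinearMap.ext fun y => (cokerMap_spec η A f g y).symm

/-! #### The abelian structure -/

/-- A morphism factors through an objectwise injective morphism `i` if it does so objectwise. -/
lemma exists_factor_of_injective {i : S ⟶ T} (hi : ∀ V W, Function.Injective (i.app V W))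
    {R : PolyBifunctor k} (η : R ⟶ T)
    (h : ∀ V W, LinearMap.range (η.app V W) ≤ LinearMap.range (i.app V W)) :
    ∃ θ : R ⟶ S, θ ≫ i = η := by
  have h1 : ∀ V W, ∃ l : R.obj V W →ₗ[k] S.obj V W, i.app V W ∘ₗ l = η.app V W := fun V W => by
    refine ⟨(LinearEquiv.ofInjective _ (hi V W)).symm.toLinearMap ∘ₗ
      (η.app V W).codRestrict _ fun x => h V W ⟨x, rfl⟩, ?_⟩
    refine LinearMap.ext fun x => ?_
    exact LinearEquiv.ofInjective_symm_apply (i.app V W) (h := hi V W) _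
  choose l hl using h1
  refine ⟨{ app := l, naturality := fun A _ _ V V' W W' f g => ?_ }, ?_⟩
  · rw [← LinearMap.cancel_left (baseChange_injective (hi V W')), ← LinearMap.comp_assoc,
      ← LinearMap.baseChange_comp, hl, η.naturality, ← LinearMap.comp_assoc, i.naturality,
      LinearMap.comp_assoc, ← LinearMap.baseChange_comp, hl]
  · exact hom_ext hl

/-- A morphism factors through an objectwise surjective morphism `q` if it does so objectwise. -/
lemma exists_factor_of_surjective {q : T ⟶ S} (hq : ∀ V W, Function.Surjective (q.app V W))
    {R : PolyBifunctor k} (η : T ⟶ R)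
    (h : ∀ V W, LinearMap.ker (q.app V W) ≤ LinearMap.ker (η.app V W)) :
    ∃ θ : S ⟶ R, q ≫ θ = η := by
  have h1 : ∀ V W, ∃ l : S.obj V W →ₗ[k] R.obj V W, l ∘ₗ q.app V W = η.app V W := fun V W => by
    refine ⟨(LinearMap.ker (q.app V W)).liftQ (η.app V W) (h V W) ∘ₗ
      ((q.app V W).quotKerEquivOfSurjective (hq V W)).symm.toLinearMap, ?_⟩
    refine LinearMap.ext fun x => ?_
    have : ((q.app V W).quotKerEquivOfSurjective (hq V W)).symm (q.app V W x) =
        (LinearMap.ker (q.app V W)).mkQ x := by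
      rw [LinearEquiv.symm_apply_eq]
      rfl
    simp only [LinearMap.comp_apply, LinearEquiv.coe_coe, this]
    rfl
  choose l hl using h1
  have hl' : ∀ V W x, l V W (q.app V W x) = η.app V W x := fun V W x =>
    LinearMap.congr_fun (hl V W) x
  refine ⟨{ app := l, naturality := fun A _ _ V V' W W' f g => hom_ext_one fun y => ?_ }, ?_⟩
  · obtain ⟨y, rfl⟩ := hq V' W y
    have h1 := LinearMap.congr_fun (q.naturality A f g) (1 ⊗ₜ y)
    have h2 := LinearMap.congr_fun (η.naturality A f g) (1 ⊗ₜ y)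
    simp only [LinearMap.comp_apply, LinearMap.baseChange_tmul] at h1 h2 ⊢
    rw [← h1, hl', ← h2, ← LinearMap.comp_apply, ← LinearMap.baseChange_comp, hl]
  · exact hom_ext hl

open Limits

lemma mono_of_injective {i : S ⟶ T} (hi : ∀ V W, Function.Injective (i.app V W)) : Mono i where
  right_cancellation η θ h := by
    ext V W x
    apply hi
    have := congrArg (fun ζ : _ ⟶ T => Hom.app ζ V W x) h
    exact this

lemma epi_of_surjective {q : T ⟶ S} (hq : ∀ V W, Function.Surjective (q.app V W)) : Epi q where
  left_cancellation η θ h := by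
    ext V W x
    obtain ⟨x, rfl⟩ := hq V W x
    have := congrArg (fun ζ : T ⟶ _ => Hom.app ζ V W x) h
    exact this

/-- An objectwise injective morphism whose image is objectwise the kernel of `η` is a kernel
of `η`. -/
def isLimitOfExact {i : S ⟶ T} (hi : ∀ V W, Function.Injective (i.app V W)) (η : T ⟶ U)
    (w : i ≫ η = 0)
    (h : ∀ V W, LinearMap.ker (η.app V W) ≤ LinearMap.range (i.app V W)) :
    IsLimit (KernelFork.ofι i w) :=
  have : Mono i := mono_of_injective hi
  have key : ∀ {R : PolyBifunctor k} (g : R ⟶ T), g ≫ η = 0 → ∃ l : R ⟶ S, l ≫ i = g := by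
    intro R g hg
    refine exists_factor_of_injective hi g fun V W => le_trans ?_ (h V W)
    rintro _ ⟨x, rfl⟩
    exact congrArg (fun ζ : R ⟶ U => Hom.app ζ V W x) hg
  KernelFork.IsLimit.ofι i w (fun g hg => Classical.choose (key g hg))
    (fun g hg => Classical.choose_spec (key g hg))
    (fun g hg m hm => by rw [← cancel_mono i, hm, Classical.choose_spec (key g hg)])

/-- An objectwise surjective morphism whose kernel is objectwise the image of `η` is a cokernel
of `η`. -/
def isColimitOfExact {q : T ⟶ S} (hq : ∀ V W, Function.Surjective (q.app V W)) (η : U ⟶ T)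
    (w : η ≫ q = 0)
    (h : ∀ V W, LinearMap.ker (q.app V W) ≤ LinearMap.range (η.app V W)) :
    IsColimit (CokernelCofork.ofπ q w) :=
  have : Epi q := epi_of_surjective hq
  have key : ∀ {R : PolyBifunctor k} (g : T ⟶ R), η ≫ g = 0 → ∃ l : S ⟶ R, q ≫ l = g := by
    intro R g hg
    refine exists_factor_of_surjective hq g fun V W => le_trans (h V W) ?_
    rintro _ ⟨x, rfl⟩
    exact congrArg (fun ζ : U ⟶ R => Hom.app ζ V W x) hg
  CokernelCofork.IsColimit.ofπ q w (fun g hg => Classical.choose (key g hg))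
    (fun g hg => Classical.choose_spec (key g hg))
    (fun g hg m hm => by rw [← cancel_epi q, hm, Classical.choose_spec (key g hg)])

lemma kerι_comp (η : T ⟶ U) : kerι η ≫ η = 0 := by
  ext V W x
  exact x.2

lemma comp_cokerπ (η : T ⟶ U) : η ≫ cokerπ η = 0 := by
  ext V W x
  exact (Submodule.Quotient.mk_eq_zero _).mpr ⟨x, rfl⟩

lemma injective_of_mono (i : T ⟶ U) [Mono i] (V W : FGModuleCat.{u} k) :
    Function.Injective (i.app V W) := by
  have h : kerι i = 0 := by
    rw [← cancel_mono i, kerι_comp, zero_comp]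
  rw [injective_iff_map_eq_zero]
  intro x hx
  exact congrArg (fun ζ : ker i ⟶ T => Hom.app ζ V W ⟨x, hx⟩) h

lemma surjective_of_epi (q : T ⟶ U) [Epi q] (V W : FGModuleCat.{u} k) :
    Function.Surjective (q.app V W) := by
  have h : cokerπ q = 0 := by
    rw [← cancel_epi q, comp_cokerπ, comp_zero]
  intro x
  have h1 := congrArg (fun ζ : U ⟶ coker q => Hom.app ζ V W x) h
  exact (Submodule.Quotient.mk_eq_zero _).mp h1

instance : HasKernels (PolyBifunctor k) where
  has_limit η := ⟨⟨⟨_, isLimitOfExact (i := kerι η)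
    (fun _ _ => Submodule.injective_subtype _) η (kerι_comp η)
    (fun _ _ x hx => ⟨⟨x, hx⟩, rfl⟩)⟩⟩⟩

instance : HasCokernels (PolyBifunctor k) where
  has_colimit η := ⟨⟨⟨_, isColimitOfExact (q := cokerπ η)
    (fun _ _ => Submodule.mkQ_surjective _) η (comp_cokerπ η)
    (fun _ _ _ hx => (Submodule.Quotient.mk_eq_zero _).mp hx)⟩⟩⟩

instance : IsNormalMonoCategory (PolyBifunctor k) where
  normalMonoOfMono i _ := ⟨
    { Z := coker i
      g := cokerπ i
      w := comp_cokerπ i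
      isLimit := isLimitOfExact (injective_of_mono i) _ _ 
        (fun _ _ _ hx => (Submodule.Quotient.mk_eq_zero _).mp hx) }⟩

instance : IsNormalEpiCategory (PolyBifunctor k) where
  normalEpiOfEpi q _ := ⟨
    { W := ker q
      g := kerι q
      w := kerι_comp q
      isColimit := isColimitOfExact (surjective_of_epi q) _ _ 
        (fun _ _ x hx => ⟨⟨x, hx⟩, rfl⟩) }⟩

/-- The zero bifunctor. -/
def zero (k : Type u) [Field k] : PolyBifunctor k where
  obj _ _ := FGModuleCat.of k PUnit.{u + 1}
  map _ _ _ _ _ _ _ _ _ := 0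
  map_id _ _ _ _ _ := hom_ext_one fun y => by simp [Subsingleton.elim y 0]
  map_comp _ _ _ _ _ _ _ _ _ _ _ _ _ := by simp
  map_ext _ _ _ _ _ _ _ _ _ _ _ := isExt_of_one fun y => by simp
  bounded := ⟨0, fun _ _ _ _ _ _ _ _ _ _ _ _ _ _ _ _ => by simp⟩

instance : HasZeroObject (PolyBifunctor k) where
  zero := ⟨zero k, by
    rw [IsZero.iff_id_eq_zero]
    ext V W x
    exact Subsingleton.elim (α := PUnit) _ _⟩

/-- `A ⊗ M ⊕ A ⊗ M'` as `A ⊗ (M ⊕ M')`, used to define direct sums of maps. -/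
def prodMapA {A M M' N N' : Type*} [CommRing A] [Algebra k A] [AddCommGroup M] [Module k M]
    [AddCommGroup M'] [Module k M'] [AddCommGroup N] [Module k N] [AddCommGroup N'] [Module k N']
    (a : A ⊗[k] M →ₗ[A] A ⊗[k] N) (b : A ⊗[k] M' →ₗ[A] A ⊗[k] N') :
    A ⊗[k] (M × M') →ₗ[A] A ⊗[k] (N × N') :=
  (LinearMap.inl k N N').baseChange A ∘ₗ a ∘ₗ (LinearMap.fst k M M').baseChange A +
    (LinearMap.inr k N N').baseChange A ∘ₗ b ∘ₗ (LinearMap.snd k M M').baseChange A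

section Prod

variable {A : Type*} [CommRing A] [Algebra k A] {M M' N N' : Type*} [AddCommGroup M] [Module k M]
  [AddCommGroup M'] [Module k M'] [AddCommGroup N] [Module k N] [AddCommGroup N'] [Module k N']

lemma fst_inl (y : A ⊗[k] M) :
    (LinearMap.fst k M M').baseChange A ((LinearMap.inl k M M').baseChange A y) = y := by
  rw [← LinearMap.comp_apply, ← LinearMap.baseChange_comp, LinearMap.fst_comp_inl]; simp

lemma snd_inr (y : A ⊗[k] M') :
    (LinearMap.snd k M M').baseChange A ((LinearMap.inr k M M').baseChange A y) = y := by
  rw [← LinearMap.comp_apply, ← LinearMap.baseChange_comp, LinearMap.snd_comp_inr]; simp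

lemma fst_inr (y : A ⊗[k] M') :
    (LinearMap.fst k M M').baseChange A ((LinearMap.inr k M M').baseChange A y) = 0 := by
  rw [← LinearMap.comp_apply, ← LinearMap.baseChange_comp, LinearMap.fst_comp_inr]; simp

lemma snd_inl (y : A ⊗[k] M) :
    (LinearMap.snd k M M').baseChange A ((LinearMap.inl k M M').baseChange A y) = 0 := by
  rw [← LinearMap.comp_apply, ← LinearMap.baseChange_comp, LinearMap.snd_comp_inl]; simp

lemma inl_fst_add_inr_snd (y : A ⊗[k] (M × M')) :
    (LinearMap.inl k M M').baseChange A ((LinearMap.fst k M M').baseChange A y) +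
      (LinearMap.inr k M M').baseChange A ((LinearMap.snd k M M').baseChange A y) = y := by
  induction y with
  | zero => simp
  | tmul a m => simp [← TensorProduct.tmul_add]
  | add x y hx hy =>
    simp only [map_add]
    nth_rewrite 3 [← hx]
    nth_rewrite 3 [← hy]
    abel

lemma prodMapA_comp {P P' : Type*} [AddCommGroup P] [Module k P] [AddCommGroup P'] [Module k P']
    (a : A ⊗[k] M →ₗ[A] A ⊗[k] N) (b : A ⊗[k] M' →ₗ[A] A ⊗[k] N')
    (a' : A ⊗[k] N →ₗ[A] A ⊗[k] P) (b' : A ⊗[k] N' →ₗ[A] A ⊗[k] P') :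
    prodMapA (a' ∘ₗ a) (b' ∘ₗ b) = prodMapA a' b' ∘ₗ prodMapA a b := by
  refine LinearMap.ext fun y => ?_
  simp only [prodMapA, LinearMap.comp_apply, LinearMap.add_apply, map_add, fst_inl, fst_inr,
    snd_inl, snd_inr, map_zero, add_zero, zero_add]

lemma fst_prodMapA (a : A ⊗[k] M →ₗ[A] A ⊗[k] N) (b : A ⊗[k] M' →ₗ[A] A ⊗[k] N') :
    (LinearMap.fst k N N').baseChange A ∘ₗ prodMapA a b =
      a ∘ₗ (LinearMap.fst k M M').baseChange A := by
  refine LinearMap.ext fun y => ?_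
  simp only [prodMapA, LinearMap.comp_apply, LinearMap.add_apply, map_add, fst_inl, fst_inr,
    add_zero]

lemma snd_prodMapA (a : A ⊗[k] M →ₗ[A] A ⊗[k] N) (b : A ⊗[k] M' →ₗ[A] A ⊗[k] N') :
    (LinearMap.snd k N N').baseChange A ∘ₗ prodMapA a b =
      b ∘ₗ (LinearMap.snd k M M').baseChange A := by
  refine LinearMap.ext fun y => ?_
  simp only [prodMapA, LinearMap.comp_apply, LinearMap.add_apply, map_add, snd_inl, snd_inr,
    zero_add]

lemma prodMapA_inl (a : A ⊗[k] M →ₗ[A] A ⊗[k] N) (b : A ⊗[k] M' →ₗ[A] A ⊗[k] N') :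
    (LinearMap.inl k N N').baseChange A ∘ₗ a =
      prodMapA a b ∘ₗ (LinearMap.inl k M M').baseChange A := by
  refine LinearMap.ext fun y => ?_
  simp only [prodMapA, LinearMap.comp_apply, LinearMap.add_apply, fst_inl, snd_inl, map_zero,
    add_zero]

lemma prodMapA_inr (a : A ⊗[k] M →ₗ[A] A ⊗[k] N) (b : A ⊗[k] M' →ₗ[A] A ⊗[k] N') :
    (LinearMap.inr k N N').baseChange A ∘ₗ b =
      prodMapA a b ∘ₗ (LinearMap.inr k M M').baseChange A := by
  refine LinearMap.ext fun y => ?_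
  simp only [prodMapA, LinearMap.comp_apply, LinearMap.add_apply, fst_inr, snd_inr, map_zero,
    zero_add]

lemma isExt_prodMapA {B : Type*} [CommRing B] [Algebra k B] {φ : A →ₐ[k] B}
    {a : A ⊗[k] M →ₗ[A] A ⊗[k] N} {b : A ⊗[k] M' →ₗ[A] A ⊗[k] N'}
    {a' : B ⊗[k] M →ₗ[B] B ⊗[k] N} {b' : B ⊗[k] M' →ₗ[B] B ⊗[k] N'}
    (ha : IsExt φ a a') (hb : IsExt φ b b') : IsExt φ (prodMapA a b) (prodMapA a' b') := by
  intro x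
  simp only [prodMapA, LinearMap.comp_apply, LinearMap.add_apply, map_add]
  rw [scalarExt_baseChange, scalarExt_baseChange, ← ha, ← hb, scalarExt_baseChange,
    scalarExt_baseChange]

lemma lcoeff_prodMapA (i : ℕ) (a : Polynomial A ⊗[k] M →ₗ[Polynomial A] Polynomial A ⊗[k] N)
    (b : Polynomial A ⊗[k] M' →ₗ[Polynomial A] Polynomial A ⊗[k] N') (t : M × M')
    (ha : ((Polynomial.lcoeff A i).restrictScalars k).rTensor N (a (1 ⊗ₜ t.1)) = 0)
    (hb : ((Polynomial.lcoeff A i).restrictScalars k).rTensor N' (b (1 ⊗ₜ t.2)) = 0) :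
    ((Polynomial.lcoeff A i).restrictScalars k).rTensor (N × N') (prodMapA a b (1 ⊗ₜ t)) = 0 := by
  simp only [prodMapA, LinearMap.comp_apply, LinearMap.add_apply, map_add]
  rw [lcoeff_baseChange, lcoeff_baseChange, LinearMap.baseChange_tmul, LinearMap.baseChange_tmul]
  simp only [LinearMap.fst_apply, LinearMap.snd_apply, ha, hb, map_zero, add_zero]

end Prod

/-- The direct sum of two bifunctors. -/
def prod (T U : PolyBifunctor k) : PolyBifunctor k where
  obj V W := FGModuleCat.of k (T.obj V W × U.obj V W)
  map A _ _ _ _ _ _ f g := prodMapA (T.map A f g) (U.map A f g)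
  map_id A _ _ V W := by
    rw [T.map_id, U.map_id]
    exact LinearMap.ext fun y => inl_fst_add_inr_snd y
  map_comp A _ _ V V' V'' W W' W'' f f' g g' := by
    rw [T.map_comp, U.map_comp]
    exact prodMapA_comp _ _ _ _
  map_ext φ V V' W W' f f' g g' hf hg :=
    isExt_prodMapA (T.map_ext φ f f' g g' hf hg) (U.map_ext φ f f' g g' hf hg)
  bounded := by
    obtain ⟨N, hN⟩ := T.bounded
    obtain ⟨N', hN'⟩ := U.bounded
    refine ⟨max N N', fun A _ _ V V' W W' f g f' g' hf hg t i hi => ?_⟩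
    exact lcoeff_prodMapA i _ _ _
      (hN A V V' W W' f g f' g' hf hg _ i (lt_of_le_of_lt (le_max_left _ _) hi))
      (hN' A V V' W W' f g f' g' hf hg _ i (lt_of_le_of_lt (le_max_right _ _) hi))

instance : HasBinaryBiproducts (PolyBifunctor k) where
  has_binary_biproduct T U := hasBinaryBiproduct_of_total
    { pt := prod T U
      fst :=
        { app := fun V W => LinearMap.fst k (T.obj V W) (U.obj V W)
          naturality := fun _ _ _ _ _ _ _ _ _ => fst_prodMapA _ _ }
      snd :=
        { app := fun V W => LinearMap.snd k (T.obj V W) (U.obj V W)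
          naturality := fun _ _ _ _ _ _ _ _ _ => snd_prodMapA _ _ }
      inl :=
        { app := fun V W => LinearMap.inl k (T.obj V W) (U.obj V W)
          naturality := fun _ _ _ _ _ _ _ _ _ => prodMapA_inl _ _ }
      inr :=
        { app := fun V W => LinearMap.inr k (T.obj V W) (U.obj V W)
          naturality := fun _ _ _ _ _ _ _ _ _ => prodMapA_inr _ _ }
      inl_fst := by ext V W x; rfl
      inl_snd := by ext V W x; rfl
      inr_fst := by ext V W x; rfl
      inr_snd := by ext V W x; rfl } (by
        ext V W x
        exact Prod.ext (add_zero _) (zero_add _))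

instance : HasFiniteProducts (PolyBifunctor k) :=
  hasFiniteProducts_of_has_binary_and_terminal

instance : Abelian (PolyBifunctor k) where

instance : HasExt.{u + 1} (PolyBifunctor k) := HasExt.standard _

end PolyBifunctor

/-! ### Bifunctor cohomology -/

section Cohomology

variable {k : Type u} [Field k] {d : ℕ}

/-- The morphism `T ∘ gl → U ∘ gl` induced by a morphism `T → U`. -/
def PolyFunctor.Hom.compGL {T U : PolyFunctor k d} (η : PolyFunctor.Hom T U) :
    T.compGL ⟶ U.compGL where
  app V W := η.app (FGModuleCat.of k (V →ₗ[k] W))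
  naturality A _ _ V V' W W' f g := η.naturality A (V := FGModuleCat.of k (V' →ₗ[k] W))
    (W := FGModuleCat.of k (V →ₗ[k] W')) (glMap f g)

/-- The cohomology `H_P^i(GL, T) = Ext^i(Γ^d ∘ gl, T ∘ gl)` of a strict polynomial functor `T`
homogeneous of degree `d`, where `Ext` is taken in the category of strict polynomial bifunctors of
bounded degree. -/
abbrev HP (T : PolyFunctor k d) (i : ℕ) : Type (u + 1) :=
  Abelian.Ext.{u + 1} (PolyFunctor.dividedPow k d).compGL T.compGL i

/-- The map `H_P^i(GL, T) → H_P^i(GL, U)` induced by a morphism `T → U`. -/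
def HPmap {T U : PolyFunctor k d} (η : PolyFunctor.Hom T U) (i : ℕ) : HP T i →ₗ[k] HP U i :=
  (Abelian.Ext.mk₀ η.compGL).postcompOfLinear k _ (add_zero i)

/-- The action of `𝔖_n` on `H_P^i(GL, ⊗^n ∘ I^{(r)})`, induced by its action on `⊗^n`. -/
def permRepHP (p : ℕ) [Fact p.Prime] (k : Type u) [Field k] [CharP k p] (n r i : ℕ) :
    Representation k (Equiv.Perm (Fin n))
      (HP ((PolyFunctor.tensorPow k n).comp (PolyFunctor.frob p k r)) i) where
  toFun σ := HPmap ((PolyFunctor.permHom k σ).whisker (PolyFunctor.frob p k r)) i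
  map_one' := by
    have h : ((PolyFunctor.permHom k (1 : Equiv.Perm (Fin n))).whisker
        (PolyFunctor.frob p k r)).compGL = 𝟙 _ :=
      PolyBifunctor.hom_ext fun V W => (permRep k n _).map_one
    refine LinearMap.ext fun x => ?_
    change x.comp (Abelian.Ext.mk₀ _) (add_zero i) = x
    rw [h, Abelian.Ext.comp_mk₀_id]
  map_mul' σ τ := by
    have h : ((PolyFunctor.permHom k (σ * τ)).whisker (PolyFunctor.frob p k r)).compGL =
        ((PolyFunctor.permHom k τ).whisker (PolyFunctor.frob p k r)).compGL ≫
          ((PolyFunctor.permHom k σ).whisker (PolyFunctor.frob p k r)).compGL :=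
      PolyBifunctor.hom_ext fun V W => (permRep k n _).map_mul σ τ
    refine LinearMap.ext fun x => ?_
    change x.comp (Abelian.Ext.mk₀ _) (add_zero i) =
      (x.comp (Abelian.Ext.mk₀ _) (add_zero i)).comp (Abelian.Ext.mk₀ _) (add_zero i)
    rw [h, ← Abelian.Ext.mk₀_comp_mk₀, Abelian.Ext.comp_assoc_of_third_deg_zero]

end Cohomology

/-! ### Young symmetrizers -/

section Young

variable {n : ℕ}

/-- The Young diagram of a partition, whose row lengths are the parts in decreasing order. -/
def diagram (lam : n.Partition) : YoungDiagram :=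
  YoungDiagram.ofRowLens (lam.parts.sort (· ≥ ·)) (Multiset.pairwise_sort _ _).sortedGE

/-- A tableau of shape `lam`: a bijective numbering of the boxes of the Young diagram (it is not
required to be increasing along rows and columns). A box `(a, b)` lies in row `a` and
column `b`. -/
abbrev Tableau (lam : n.Partition) : Type := Fin n ≃ {c : ℕ × ℕ // c ∈ (diagram lam).cells}

/-- The partition `(1, …, 1)` of `n`. -/
def onesPartition (n : ℕ) : n.Partition :=
  Nat.Partition.ofSums n (Multiset.replicate n 1) (by simp)

variable (k : Type u) [Field k] {lam : n.Partition} (t : Tableau lam)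

open Classical in
/-- The element `a_λ`: the sum of the permutations which preserve the rows of the tableau. -/
def rowSum : MonoidAlgebra k (Equiv.Perm (Fin n)) :=
  ∑ σ : Equiv.Perm (Fin n) with ∀ j, (t (σ j)).1.1 = (t j).1.1, MonoidAlgebra.of k _ σ

open Classical in
/-- The element `b_λ`: the alternating sum of the permutations which preserve the columns of the
tableau. -/
def colSum : MonoidAlgebra k (Equiv.Perm (Fin n)) :=
  ∑ σ : Equiv.Perm (Fin n) with ∀ j, (t (σ j)).1.2 = (t j).1.2,
    ((Equiv.Perm.sign σ : ℤ) : k) • MonoidAlgebra.of k _ σ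

/-- The Young symmetrizer `c_λ = a_λ b_λ`. -/
def youngSymmetrizer : MonoidAlgebra k (Equiv.Perm (Fin n)) :=
  rowSum k t * colSum k t

/-- The left ideal `k𝔖_n · c_λ` of the group algebra. -/
def youngIdeal : Submodule k (MonoidAlgebra k (Equiv.Perm (Fin n))) :=
  LinearMap.range (LinearMap.mulRight k (youngSymmetrizer k t))

instance : Module.Finite k (youngIdeal k t) :=
  haveI : Module.Finite k (MonoidAlgebra k (Equiv.Perm (Fin n))) := inferInstance
  inferInstance

lemma youngIdeal_mul_mem (σ : Equiv.Perm (Fin n)) (x : MonoidAlgebra k (Equiv.Perm (Fin n)))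
    (hx : x ∈ youngIdeal k t) :
    LinearMap.mulLeft k (MonoidAlgebra.of k _ σ) x ∈ youngIdeal k t := by
  obtain ⟨y, rfl⟩ := hx
  exact ⟨MonoidAlgebra.of k _ σ * y, by simp [mul_assoc]⟩

/-- The representation `V_λ = k𝔖_n · c_λ` of `𝔖_n`, by left multiplication. -/
def youngRep : Representation k (Equiv.Perm (Fin n)) (youngIdeal k t) where
  toFun σ := (LinearMap.mulLeft k (MonoidAlgebra.of k _ σ)).restrict (youngIdeal_mul_mem k t σ)
  map_one' := by
    ext x : 2
    simp [LinearMap.restrict_apply, ← MonoidAlgebra.one_def]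
  map_mul' σ τ := by
    ext x : 2
    simp only [LinearMap.restrict_apply, LinearMap.mulLeft_apply, map_mul, Module.End.mul_apply,
      mul_assoc]

/-- The vector space `s^λ(W) = k𝔖_n c_λ ⊗_{k𝔖_n} W`, for a `k𝔖_n`-module `W`. -/
abbrev schur {W : Type*} [AddCommGroup W] [Module k W]
    (τ : Representation k (Equiv.Perm (Fin n)) W) : Type _ :=
  relTensor (youngRep k t) τ

/-- The functor `S^λ`, `S^λ(V) = s^λ(V^{⊗ n})`. -/
def schurFunctor : PolyFunctor k n :=
  PolyFunctor.relTensorPow (youngRep k t)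

/-- The morphism `⊗^n → S^λ`, `w ↦ x ⊗ w`, for `x ∈ k𝔖_n c_λ`. -/
def schurIns (x : youngIdeal k t) : PolyFunctor.Hom (PolyFunctor.tensorPow k n) (schurFunctor k t) :=
  PolyFunctor.relTensorPowIns (youngRep k t) x

variable (n) in
/-- The sign representation `k_sgn` of `𝔖_n`. -/
def signRep : Representation k (Equiv.Perm (Fin n)) k where
  toFun σ := ((Equiv.Perm.sign σ : ℤ) : k) • LinearMap.id
  map_one' := by ext; simp
  map_mul' σ τ := by ext; simp [mul_comm]

end Young

end StrictPoly

end

open StrictPoly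

/-! The theorem is an averaging argument. Let `G` be the symmetric group on `n` letters. Since p >
n, its order n! is invertible in k. For a finite-dimensional representation X of G and a functor F
with a G-action, put Q = X ⊗_{kG} F. The morphisms ι_x : F → Q, w ↦ x ⊗ w, have companions in the
other direction: every linear form ξ on X gives s_ξ : Q → F, x ⊗ w ↦ ∑_σ ξ(σx) σw, which is well
defined because replacing (x, w) by (τx, τw) only reindexes the sum. For a basis b_j of X with dual
basis b_j^*, the morphism |G|⁻¹ ∑_j ι_{b_j} ∘ s_{b_j^*} sends x ⊗ w to |G|⁻¹ ∑_σ σx ⊗ σw = x ⊗ w. It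
is therefore the identity of Q, so Q is a direct summand of a finite sum of copies of F.

These identities are k-linear relations between morphisms, so they survive any k-linear functor, in
particular Ext^i(Γ, -). The same formula, with the maps s_ξ replaced by those they induce on Ext,
then inverts the natural map X ⊗_{kG} Ext^i(Γ, F) → Ext^i(Γ, Q). Neither resolutions nor the
structure of Γ^d are needed, nor any quasi-idempotence of the Young symmetrizer: the argument works
for every X. The abstract statement is `exists_relTensor_equiv_ext`.

`exists_relTensor_equiv_HP` transfers it to bifunctor cohomology. Precomposition with I^{(r)} and gl
is harmless, since every identity is checked on the components of the untwisted functors. Taking X =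
k𝔖_n c_λ gives the statement on S^λ. S^n and Λ^n are defined in their own way and not as relative
tensor products, so they are treated by giving the projection from ⊗^n together with a
symmetrization or antisymmetrization map back, with X the trivial or the sign character
(`symPow_HP_equiv`, `extPow_HP_equiv`).

It remains to compare these characters with s^{(n)} and s^{(1,…,1)}. For a single row c_λ is the sum
of all permutations, for a single column it is their signed sum. In both cases k𝔖_n c_λ is the line
spanned by c_λ, on which the group acts through the expected character (`exists_equiv_youngIdeal`).
-/

noncomputable section

namespace StrictPoly

/-! ### Averaging over a finite group in a linear abelian category -/

section Averaging

variable {k : Type*} [Field k] {G : Type*} [Group G] [Fintype G]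

/-- If `Q` is objectwise the relative tensor product `X ⊗_{kG} F`, in the sense that it carries
morphisms `ι x : F ⟶ Q` which are balanced and jointly epimorphic, and averaging maps
`s ξ : Q ⟶ F`, then `Ext(Γ, Q)` is the relative tensor product `X ⊗_{kG} Ext(Γ, F)`, provided that
the order of `G` is invertible. -/
lemma exists_relTensor_equiv_ext {C : Type*} [Category* C] [Abelian C] [Linear k C] [HasExt.{u} C]
    {Γ F Q : C} (hG : (Fintype.card G : k) ≠ 0) {X : Type*} [AddCommGroup X] [Module k X]
    [Module.Finite k X] (ρ : Representation k G X) (i : ℕ)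
    (τ : Representation k G (Abelian.Ext.{u} Γ F i)) (α : G → (F ⟶ F))
    (hτ : ∀ σ w, τ σ w = w.comp (Abelian.Ext.mk₀ (α σ)) (add_zero i))
    (ι : X →ₗ[k] (F ⟶ Q)) (hι : ∀ σ x, α σ ≫ ι (ρ σ x) = ι x)
    (hepi : ∀ f : Q ⟶ Q, (∀ x, ι x ≫ f = ι x) → f = 𝟙 Q)
    (s : (X →ₗ[k] k) → (Q ⟶ F)) (hs : ∀ ξ x, ι x ≫ s ξ = ∑ σ, ξ (ρ σ x) • α σ) :
    ∃ e : relTensor ρ τ ≃ₗ[k] Abelian.Ext.{u} Γ Q i, ∀ x w,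
      e (relTensorIns ρ τ x w) = w.comp (Abelian.Ext.mk₀ (ι x)) (add_zero i) := by
  classical
  let b := Module.finBasis k X
  let Φ₀ : X →ₗ[k] Abelian.Ext.{u} Γ F i →ₗ[k] Abelian.Ext.{u} Γ Q i :=
    LinearMap.mk₂ k (fun x w => w.comp (Abelian.Ext.mk₀ (ι x)) (add_zero i))
      (fun x y w => by rw [map_add, Abelian.Ext.mk₀_add, Abelian.Ext.comp_add])
      (fun c x w => by rw [map_smul, Abelian.Ext.mk₀_smul, Abelian.Ext.comp_smul])
      (fun x v w => by rw [Abelian.Ext.add_comp])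
      (fun c x w => by rw [Abelian.Ext.smul_comp])
  -- The action on Ext is composition with `α σ`, so associativity reduces balancedness on Ext to
  -- the relation `hι` between morphisms.
  have hΦ₀ : ∀ σ, TensorProduct.lift Φ₀ ∘ₗ (ρ.tprod τ) σ = TensorProduct.lift Φ₀ := by
    intro σ
    refine TensorProduct.ext' fun x w => ?_
    change (τ σ w).comp (Abelian.Ext.mk₀ (ι (ρ σ x))) (add_zero i) =
      w.comp (Abelian.Ext.mk₀ (ι x)) (add_zero i)
    rw [hτ, Abelian.Ext.comp_assoc_of_third_deg_zero, Abelian.Ext.mk₀_comp_mk₀, hι]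
  let Φ : relTensor ρ τ →ₗ[k] Abelian.Ext.{u} Γ Q i :=
    Representation.Coinvariants.lift _ (TensorProduct.lift Φ₀) hΦ₀
  have hΦ : ∀ x w, Φ (relTensorIns ρ τ x w) =
      w.comp (Abelian.Ext.mk₀ (ι x)) (add_zero i) := fun x w => by
    simp [Φ, Φ₀, relTensorIns]
  -- The inverse is q ↦ |G|⁻¹ ∑_j b_j ⊗ (s_{b_j^*})_* q. The factor |G|⁻¹ compensates the sum over G
  -- contained in each averaging map.
  let Ψ : Abelian.Ext.{u} Γ Q i →ₗ[k] relTensor ρ τ :=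
    (Fintype.card G : k)⁻¹ • ∑ j, relTensorIns ρ τ (b j) ∘ₗ
      (Abelian.Ext.mk₀ (s (b.coord j))).postcompOfLinear k _ (add_zero i)
  have hΨ : ∀ q, Ψ q = (Fintype.card G : k)⁻¹ • ∑ j, relTensorIns ρ τ (b j)
      (q.comp (Abelian.Ext.mk₀ (s (b.coord j))) (add_zero i)) := fun q => by
    simp [Ψ]
  have hexp : ∀ x, ∑ j, b.coord j x • b j = x := fun x => b.sum_repr x
  -- This exhibits Q as a summand of a finite sum of copies of F. After precomposition with `ι x`,
  -- summing over the basis reassembles `ρ σ x`, and each of the |G| terms `α σ ≫ ι (ρ σ x)` equals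
  -- `ι x`.
  have hsec : (Fintype.card G : k)⁻¹ • ∑ j, s (b.coord j) ≫ ι (b j) = 𝟙 Q := by
    apply hepi
    intro x
    have h1 : ∑ j, (∑ σ, b.coord j (ρ σ x) • α σ) ≫ ι (b j) = ∑ _σ : G, ι x := by
      simp only [Preadditive.sum_comp, Linear.smul_comp]
      rw [Finset.sum_comm]
      refine Finset.sum_congr rfl fun σ _ => ?_
      rw [← hι σ x]
      -- Only the argument of `ι` is expanded in the basis; the occurrence inside the coordinate has
      -- to stay.
      nth_rewrite 2 [← hexp (ρ σ x)]
      simp only [map_sum, map_smul, Preadditive.comp_sum, Linear.comp_smul]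
    simp only [Linear.comp_smul, Preadditive.comp_sum, ← Category.assoc, hs, h1]
    rw [Finset.sum_const, Finset.card_univ, ← Nat.cast_smul_eq_nsmul k, smul_smul,
      inv_mul_cancel₀ hG, one_smul]
  -- This is `hsec` after applying the linear functor Ext^i(Γ, -).
  have hΦΨ : ∀ q, Φ (Ψ q) = q := by
    intro q
    rw [hΨ, map_smul, map_sum]
    simp only [hΦ, Abelian.Ext.comp_assoc_of_third_deg_zero, Abelian.Ext.mk₀_comp_mk₀]
    rw [← Abelian.Ext.comp_sum, ← Abelian.Ext.mk₀_sum, ← Abelian.Ext.comp_smul,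
      ← Abelian.Ext.mk₀_smul, hsec, Abelian.Ext.comp_mk₀_id]
  -- The same computation one level up, with the balancing relation of the tensor product itself in
  -- place of `hι`: the composite is |G|⁻¹ ∑_σ σx ⊗ σw, and every summand equals x ⊗ w.
  have hΨΦ : ∀ x w, Ψ (Φ (relTensorIns ρ τ x w)) = relTensorIns ρ τ x w := by
    intro x w
    rw [hΦ, hΨ]
    have h1 : ∑ j, relTensorIns ρ τ (b j) ((w.comp (Abelian.Ext.mk₀ (ι x)) (add_zero i)).comp
        (Abelian.Ext.mk₀ (s (b.coord j))) (add_zero i)) =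
        ∑ _σ : G, relTensorIns ρ τ x w := by
      simp only [Abelian.Ext.comp_assoc_of_third_deg_zero, Abelian.Ext.mk₀_comp_mk₀, hs,
        Abelian.Ext.mk₀_sum, Abelian.Ext.comp_sum, Abelian.Ext.mk₀_smul, Abelian.Ext.comp_smul,
        ← hτ, map_sum, map_smul]
      rw [Finset.sum_comm]
      refine Finset.sum_congr rfl fun σ _ => ?_
      rw [← LinearMap.congr_fun (relTensorIns_comp ρ τ σ x) w, LinearMap.comp_apply]
      nth_rewrite 2 [← hexp (ρ σ x)]
      simp only [map_sum, map_smul, LinearMap.sum_apply, LinearMap.smul_apply]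
    rw [h1, Finset.sum_const, Finset.card_univ, ← Nat.cast_smul_eq_nsmul k, smul_smul,
      inv_mul_cancel₀ hG, one_smul]
  refine ⟨LinearEquiv.ofLinearMap Φ Ψ (LinearMap.ext hΦΨ) (LinearMap.ext fun y => ?_), hΦ⟩
  have hy : y ∈ ⨆ x, LinearMap.range (relTensorIns ρ τ x) := by
    rw [iSup_range_relTensorIns]; trivial
  induction hy using Submodule.iSup_induction' with
  | mem x y hy =>
    obtain ⟨w, rfl⟩ := hy
    exact hΨΦ x w
  | zero => simp
  | add a b _ _ ha hb => rw [map_add, ha, hb, map_add]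

end Averaging

/-! ### Transfer to strict polynomial functors and their cohomology -/

section Balanced

variable {k : Type u} [Field k] {n : ℕ} {X : Type*} [AddCommGroup X] [Module k X]

/-- A family of linear maps whose images together span is jointly right cancellable after extension
of scalars. -/
lemma hom_ext_of_iSup_range {k A : Type*} [Field k] [CommRing A] [Algebra k A] {Y M Q N : Type*}
    [AddCommGroup M] [Module k M] [AddCommGroup Q] [Module k Q] [AddCommGroup N] [Module A N]
    {π : Y → M →ₗ[k] Q} (hπ : ⨆ y, LinearMap.range (π y) = ⊤) {g g' : A ⊗[k] Q →ₗ[A] N}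
    (h : ∀ y, g ∘ₗ (π y).baseChange A = g' ∘ₗ (π y).baseChange A) : g = g' := by
  apply hom_ext_one
  intro q
  have hq : q ∈ ⨆ y, LinearMap.range (π y) := by rw [hπ]; trivial
  induction hq using Submodule.iSup_induction' with
  | mem y q hq =>
    obtain ⟨m, rfl⟩ := hq
    simpa using LinearMap.congr_fun (h y) (1 ⊗ₜ m)
  | zero => simp
  | add a b _ _ ha hb => simp only [TensorProduct.tmul_add, map_add, ha, hb]

lemma linearMap_ext_of_iSup_range {k : Type*} [Field k] {Y M Q N : Type*}
    [AddCommGroup M] [Module k M] [AddCommGroup Q] [Module k Q] [AddCommGroup N] [Module k N]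
    {π : Y → M →ₗ[k] Q} (hπ : ⨆ y, LinearMap.range (π y) = ⊤) {g g' : Q →ₗ[k] N}
    (h : ∀ y, g ∘ₗ π y = g' ∘ₗ π y) : g = g' := by
  refine LinearMap.ext fun q => ?_
  have hq : q ∈ ⨆ y, LinearMap.range (π y) := by rw [hπ]; trivial
  induction hq using Submodule.iSup_induction' with
  | mem y q hq =>
    obtain ⟨m, rfl⟩ := hq
    exact LinearMap.congr_fun (h y) m
  | zero => simp
  | add a b _ _ ha hb => simp only [map_add, ha, hb]

lemma baseChange_sum_smul_apply {k A J M N : Type*} [Field k] [CommRing A] [Algebra k A] [Fintype J]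
    [AddCommGroup M] [Module k M] [AddCommGroup N] [Module k N] (c : J → k) (l : J → M →ₗ[k] N)
    (x : A ⊗[k] M) :
    (∑ j, c j • l j).baseChange A x = ∑ j, c j • (l j).baseChange A x := by
  induction x with
  | zero => simp
  | tmul a x => simp [TensorProduct.tmul_sum]
  | add x y hx hy => simp only [map_add, hx, hy, smul_add, Finset.sum_add_distrib]

/-- Maps `Q → M^{⊗ n}` which are given by averaging over the symmetric group are natural. -/
lemma averaging_naturality {k A : Type*} [Field k] [CommRing A] [Algebra k A] {n : ℕ}
    {Y M N Q R : Type*} [AddCommGroup M] [Module k M] [AddCommGroup N] [Module k N]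
    [AddCommGroup Q] [Module k Q] [AddCommGroup R] [Module k R]
    {π : Y → (⨂[k]^n M) →ₗ[k] Q} {π' : Y → (⨂[k]^n N) →ₗ[k] R}
    (hπ : ⨆ y, LinearMap.range (π y) = ⊤) (g : A ⊗[k] Q →ₗ[A] A ⊗[k] R)
    (f : A ⊗[k] M →ₗ[A] A ⊗[k] N)
    (hg : ∀ y, (π' y).baseChange A ∘ₗ tensorPowMap n f = g ∘ₗ (π y).baseChange A)
    (c : Equiv.Perm (Fin n) → Y → k) {s : Q →ₗ[k] ⨂[k]^n M} {s' : R →ₗ[k] ⨂[k]^n N}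
    (hs : ∀ y, s ∘ₗ π y = ∑ σ, c σ y • permRep k n M σ)
    (hs' : ∀ y, s' ∘ₗ π' y = ∑ σ, c σ y • permRep k n N σ) :
    s'.baseChange A ∘ₗ g = tensorPowMap n f ∘ₗ s.baseChange A := by
  -- The map `s` is determined by its composites with the spanning family `π`, and these are
  -- combinations of permutations with coefficients independent of the space. Naturality thus
  -- reduces to the fact that permutations commute with f^{⊗n}; no explicit description of `s` is
  -- needed.
  refine hom_ext_of_iSup_range hπ fun y => ?_
  rw [LinearMap.comp_assoc, ← hg, LinearMap.comp_assoc, ← LinearMap.baseChange_comp,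
    ← LinearMap.comp_assoc, ← LinearMap.baseChange_comp, hs, hs']
  refine LinearMap.ext fun z => ?_
  have h1 := fun σ => LinearMap.congr_fun (permRep_comp_tensorPowMap σ f) z
  simp only [LinearMap.comp_apply] at h1
  rw [LinearMap.comp_apply, LinearMap.comp_apply, baseChange_sum_smul_apply,
    baseChange_sum_smul_apply, map_sum]
  refine Finset.sum_congr rfl fun σ _ => ?_
  rw [h1, LinearMap.map_smul_of_tower]

/-- A prime p divides n! exactly when p ≤ n. This is the only point where the inequality p > n does
its work. -/
lemma natCast_card_perm_ne_zero {p : ℕ} [Fact p.Prime] (k : Type*) [Field k] [CharP k p] {n : ℕ}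
    (hn : n < p) : (Fintype.card (Equiv.Perm (Fin n)) : k) ≠ 0 := by
  rw [Fintype.card_perm, Fintype.card_fin, Ne, CharP.cast_eq_zero_iff k p,
    (Fact.out : p.Prime).dvd_factorial]
  exact hn.not_ge

/-- A balanced family of morphisms `ι x : ⊗^n → Q`, jointly epimorphic and with averaging maps in
the other direction, identifies `H_P(GL, Q ∘ I^{(r)})` with the relative tensor product
`X ⊗_{k𝔖_n} H_P(GL, ⊗^n ∘ I^{(r)})`. -/
lemma exists_relTensor_equiv_HP {p : ℕ} [Fact p.Prime] [CharP k p] (hn : n < p) (r i : ℕ)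
    [Module.Finite k X] (ρ : Representation k (Equiv.Perm (Fin n)) X) (Q : PolyFunctor k n)
    (ι : X → PolyFunctor.Hom (PolyFunctor.tensorPow k n) Q)
    (hspan : ∀ V, ⨆ x, LinearMap.range ((ι x).app V) = ⊤)
    (Λ : ∀ V : FGModuleCat.{u} k, X →ₗ[k] (⨂[k]^n V) →ₗ[k] Q.obj V)
    (hΛ : ∀ x V, (ι x).app V = Λ V x)
    (hbal : ∀ V σ x, Λ V (ρ σ x) ∘ₗ permRep k n V σ = Λ V x)
    (havg : ∀ (ξ : X →ₗ[k] k) V, ∃ s : Q.obj V →ₗ[k] (⨂[k]^n V),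
      ∀ x, s ∘ₗ Λ V x = ∑ σ, ξ (ρ σ x) • permRep k n V σ) :
    ∃ e : relTensor ρ (permRepHP p k n r i) ≃ₗ[k] HP (Q.comp (PolyFunctor.frob p k r)) i,
      ∀ x w, e (relTensorIns ρ (permRepHP p k n r i) x w) =
        HPmap ((ι x).whisker (PolyFunctor.frob p k r)) i w := by
  choose s hs using havg
  -- The maps `s ξ V` were chosen separately for each V; their averaging formula alone makes them a
  -- morphism of functors.
  let S : (X →ₗ[k] k) → PolyFunctor.Hom Q (PolyFunctor.tensorPow k n) := fun ξ =>
    { app := s ξ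
      naturality := fun A _ _ V W f =>
        averaging_naturality (hspan V) (Q.map A f) f
          (fun x => (ι x).naturality A f) (fun σ x => ξ (ρ σ x))
          (fun x => (congrArg (s ξ V ∘ₗ ·) (hΛ x V)).trans (hs ξ V x))
          (fun x => (congrArg (s ξ W ∘ₗ ·) (hΛ x W)).trans (hs ξ W x)) }
  -- Linearity in x is a statement about components, and there it is the linearity of `Λ`. This is
  -- why the family `ι` is accompanied by `Λ` in the hypotheses.
  let J : X →ₗ[k] (((PolyFunctor.tensorPow k n).comp (PolyFunctor.frob p k r)).compGL ⟶
      (Q.comp (PolyFunctor.frob p k r)).compGL) :=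
    { toFun := fun x => ((ι x).whisker (PolyFunctor.frob p k r)).compGL
      map_add' := fun x y => PolyBifunctor.hom_ext fun V W => by
        change (ι (x + y)).app _ = (ι x).app _ + (ι y).app _
        rw [hΛ, hΛ, hΛ, map_add]; rfl
      map_smul' := fun c x => PolyBifunctor.hom_ext fun V W => by
        change (ι (c • x)).app _ = c • (ι x).app _
        rw [hΛ, hΛ, map_smul]; rfl }
  have sum_app : ∀ {T U : PolyBifunctor k} (f : Equiv.Perm (Fin n) → (T ⟶ U)) (V W),
      PolyBifunctor.Hom.app (∑ σ, f σ : T ⟶ U) V W = ∑ σ, PolyBifunctor.Hom.app (f σ) V W :=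
    fun {T U} f V W => map_sum ({ toFun := fun f => PolyBifunctor.Hom.app f V W, map_zero' := rfl, map_add' := fun _ _ => rfl } :
      (T ⟶ U) →+ (T.obj V W →ₗ[k] U.obj V W)) f _
  refine exists_relTensor_equiv_ext (natCast_card_perm_ne_zero k hn) ρ i (permRepHP p k n r i)
    (fun σ => ((PolyFunctor.permHom k σ).whisker (PolyFunctor.frob p k r)).compGL)
    (fun σ w => rfl) J (fun σ x => PolyBifunctor.hom_ext fun V W => ?_) (fun f hf => ?_)
    (fun ξ => ((S ξ).whisker (PolyFunctor.frob p k r)).compGL)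
    (fun ξ x => PolyBifunctor.hom_ext fun V W => ?_)
  -- Here and in the next two goals, the component at (V, W) is the component of the untwisted
  -- morphism at Hom(V, W)^{(r)}, so the hypotheses apply directly at that space.
  · change (ι (ρ σ x)).app _ ∘ₗ permRep k n _ σ = (ι x).app _
    rw [hΛ, hΛ]
    exact hbal _ σ x
  -- Joint epimorphy holds objectwise, because the images of the `ι x` span.
  · refine PolyBifunctor.hom_ext fun V W => ?_
    refine linearMap_ext_of_iSup_range
      (hspan ((PolyFunctor.frob p k r).obj (FGModuleCat.of k (V →ₗ[k] W)))) fun x => ?_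
    exact congrArg (fun g => PolyBifunctor.Hom.app g V W) (hf x)
  · rw [sum_app]
    change s ξ _ ∘ₗ (ι x).app _ = _
    rw [hΛ]
    exact hs ξ _ x

end Balanced

/-! ### The functors X ⊗ ⊗^n, S^n and Λ^n -/

section Functors

variable {k : Type u} [Field k] {n : ℕ} {p : ℕ} [Fact p.Prime] [CharP k p]

/-- Balancedness and spanning are built into the relative tensor product, so only the averaging maps
x ⊗ y ↦ ∑_σ ξ(σx) σy have to be constructed. With X = k𝔖_n c_λ this is the statement about S^λ. -/
lemma relTensorPow_HP_equiv (hn : n < p) (r i : ℕ) {X : Type u} [AddCommGroup X] [Module k X]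
    [Module.Finite k X] (ρ : Representation k (Equiv.Perm (Fin n)) X) :
    ∃ e : relTensor ρ (permRepHP p k n r i) ≃ₗ[k]
        HP ((PolyFunctor.relTensorPow ρ).comp (PolyFunctor.frob p k r)) i,
      ∀ x w, e (relTensorIns ρ (permRepHP p k n r i) x w) =
        HPmap ((PolyFunctor.relTensorPowIns ρ x).whisker (PolyFunctor.frob p k r)) i w := by
  refine exists_relTensor_equiv_HP hn r i ρ (PolyFunctor.relTensorPow ρ)
    (PolyFunctor.relTensorPowIns ρ) (fun V => iSup_range_relTensorIns ρ (permRep k n V))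
    (fun V => relTensorIns ρ (permRep k n V)) (fun x V => rfl)
    (fun V σ x => relTensorIns_comp ρ (permRep k n V) σ x) (fun ξ V => ?_)
  let Φ : X →ₗ[k] (⨂[k]^n V) →ₗ[k] (⨂[k]^n V) :=
    ∑ σ, (ξ ∘ₗ ρ σ).smulRight (permRep k n V σ)
  have hΦ : ∀ x, Φ x = ∑ σ, ξ (ρ σ x) • permRep k n V σ := fun x => by simp [Φ]
  have hinv : ∀ σ, TensorProduct.lift Φ ∘ₗ (ρ.tprod (permRep k n V)) σ =
      TensorProduct.lift Φ := by
    intro τ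
    refine TensorProduct.ext' fun x y => ?_
    change Φ (ρ τ x) (permRep k n V τ y) = Φ x y
    rw [hΦ, hΦ, LinearMap.sum_apply, LinearMap.sum_apply]
    -- Replacing (x, y) by (τx, τy) turns the term of σ into the term of στ, so the sum descends to
    -- coinvariants.
    refine Fintype.sum_equiv (Equiv.mulRight τ) _ _ fun σ => ?_
    simp [map_mul]
  refine ⟨Representation.Coinvariants.lift _ _ hinv, fun x => LinearMap.ext fun y => ?_⟩
  rw [← hΦ]
  exact TensorProduct.lift.tmul x y

lemma iSup_range_smul_eq_top {k M Q : Type*} [Field k] [AddCommGroup M] [Module k M]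
    [AddCommGroup Q] [Module k Q] {f : M →ₗ[k] Q} (hf : Function.Surjective f) :
    ⨆ c : k, LinearMap.range (c • f) = ⊤ := by
  rw [eq_top_iff, ← LinearMap.range_eq_top.mpr hf]
  exact (le_of_eq (by rw [one_smul])).trans (le_iSup (fun c : k => LinearMap.range (c • f)) 1)

/-- A scalar multiple of a morphism of strict polynomial functors. -/
def PolyFunctor.Hom.smul {T U : PolyFunctor k n} (c : k) (η : PolyFunctor.Hom T U) :
    PolyFunctor.Hom T U where
  app V := c • η.app V
  naturality A _ _ V W f := by
    rw [LinearMap.baseChange_smul, LinearMap.baseChange_smul]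
    refine LinearMap.ext fun x => ?_
    have h := LinearMap.congr_fun (η.naturality A f) x
    simp only [LinearMap.comp_apply, LinearMap.smul_apply, LinearMap.map_smul_of_tower] at h ⊢
    rw [h]

lemma HPmap_smul_whisker {d e : ℕ} {T U : PolyFunctor k d} (c : k) (η : PolyFunctor.Hom T U)
    (Q : PolyFunctor k e) (i : ℕ) (w : HP (T.comp Q) i) :
    HPmap ((η.smul c).whisker Q) i w = c • HPmap (η.whisker Q) i w := by
  change w.comp (Abelian.Ext.mk₀ (c • (η.whisker Q).compGL)) (add_zero i) =
    c • w.comp (Abelian.Ext.mk₀ (η.whisker Q).compGL) (add_zero i)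
  rw [Abelian.Ext.mk₀_smul, Abelian.Ext.comp_smul]

/-- For a one-dimensional X a linear form ξ is multiplication by ξ(1), and ξ(ρ(σ)c) = c ξ(1) ρ(σ)1.
One map `s` that averages against the character therefore yields all the required averaging maps by
scaling. -/
lemma character_averaging {k G M Q : Type*} [Field k] [Group G] [Fintype G] [AddCommGroup M]
    [Module k M] [AddCommGroup Q] [Module k Q] {ρ : Representation k G k}
    (hρ : ∀ σ c, ρ σ c = c * ρ σ 1) (ξ : k →ₗ[k] k) {π : M →ₗ[k] Q} {s : Q →ₗ[k] M}
    {τ : Representation k G M} (hs : s ∘ₗ π = ∑ σ, ρ σ 1 • τ σ) (c : k) :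
    (ξ 1 • s) ∘ₗ (c • π) = ∑ σ, ξ (ρ σ c) • τ σ := by
  rw [LinearMap.smul_comp, LinearMap.comp_smul, hs, smul_smul, Finset.smul_sum]
  refine Finset.sum_congr rfl fun σ _ => ?_
  have h1 : ξ (ρ σ c) = ρ σ c * ξ 1 := by rw [← smul_eq_mul, ← map_smul, smul_eq_mul, mul_one]
  rw [smul_smul, h1, hρ σ c]
  congr 1
  ring

/-- The case of `exists_relTensor_equiv_HP` in which `X` is a character `χ` of `𝔖_n`. -/
lemma exists_character_equiv_HP (hn : n < p) (r i : ℕ)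
    (ρ : Representation k (Equiv.Perm (Fin n)) k) (Q : PolyFunctor k n)
    (π : PolyFunctor.Hom (PolyFunctor.tensorPow k n) Q)
    (hsurj : ∀ V, Function.Surjective (π.app V))
    (hbal : ∀ V σ, ρ σ 1 • (π.app V ∘ₗ permRep k n V σ) = π.app V)
    (havg : ∀ V, ∃ s : Q.obj V →ₗ[k] (⨂[k]^n V),
      s ∘ₗ π.app V = ∑ σ, ρ σ 1 • permRep k n V σ) :
    ∃ e : relTensor ρ (permRepHP p k n r i) ≃ₗ[k] HP (Q.comp (PolyFunctor.frob p k r)) i,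
      ∀ c w, e (relTensorIns ρ (permRepHP p k n r i) c w) =
        c • HPmap (π.whisker (PolyFunctor.frob p k r)) i w := by
  -- A linear endomorphism of k is multiplication by its value at 1, so `ρ σ 1` is the value of the
  -- character at σ.
  have hρ : ∀ σ c, ρ σ c = c * ρ σ 1 := fun σ c => by
    rw [← smul_eq_mul, ← map_smul, smul_eq_mul, mul_one]
  obtain ⟨e, he⟩ := exists_relTensor_equiv_HP hn r i ρ Q (fun c => π.smul c)
    (fun V => iSup_range_smul_eq_top (hsurj V))
    (fun V => (LinearMap.id : k →ₗ[k] k).smulRight (π.app V)) (fun c V => rfl)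
    (fun V σ c => by
      change ρ σ c • π.app V ∘ₗ permRep k n V σ = c • π.app V
      refine (congrArg (· • (π.app V ∘ₗ permRep k n V σ)) (hρ σ c)).trans ?_
      rw [mul_smul]
      exact congrArg (c • ·) (hbal V σ))
    (fun ξ V => by
      obtain ⟨s, hs⟩ := havg V
      exact ⟨ξ 1 • s, character_averaging hρ ξ hs⟩)
  exact ⟨e, fun c w => (he c w).trans (HPmap_smul_whisker c π _ i w)⟩

/-- The averaging map is the norm S^n → ⊗^n, which sends the class of y to ∑_σ σy. It is defined on
coinvariants because right translation by τ permutes the summands. -/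
lemma symPow_HP_equiv (hn : n < p) (r i : ℕ) :
    ∃ e : relTensor (Representation.trivial k (Equiv.Perm (Fin n)) k) (permRepHP p k n r i) ≃ₗ[k]
        HP ((PolyFunctor.symPow k n).comp (PolyFunctor.frob p k r)) i,
      ∀ c w, e (relTensorIns (Representation.trivial k (Equiv.Perm (Fin n)) k)
          (permRepHP p k n r i) c w) =
        c • HPmap ((PolyFunctor.symProj k n).whisker (PolyFunctor.frob p k r)) i w := by
  refine exists_character_equiv_HP hn r i _ _ _
    (fun V => Representation.Coinvariants.mk_surjective _) (fun V σ => ?_) (fun V => ?_)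
  · refine (one_smul k _).trans (LinearMap.ext fun y => ?_)
    exact Representation.Coinvariants.mk_self_apply (permRep k n V) σ y
  · refine ⟨Representation.Coinvariants.lift (permRep k n V) (∑ σ, permRep k n V σ) fun τ => ?_, ?_⟩
    · refine (map_sum (LinearMap.lcomp k _ (permRep k n V τ)) _ _).trans ?_
      refine Fintype.sum_equiv (Equiv.mulRight τ) _ _ fun σ => ?_
      rw [Equiv.coe_mulRight, map_mul]
      rfl
    · refine Eq.trans (Representation.Coinvariants.lift_comp_mk _ _ _) ?_
      exact Finset.sum_congr rfl fun σ _ => (one_smul k _).symm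

lemma signRep_one (σ : Equiv.Perm (Fin n)) :
    signRep n k σ 1 = ((Equiv.Perm.sign σ : ℤ) : k) := by
  simp [signRep]

/-- The averaging map is antisymmetrization Λ^n → ⊗^n, induced by the alternatization of the
universal multilinear map. The projection is balanced for the sign character because permuting the
factors of a wedge product costs a sign, whose square is 1. -/
lemma extPow_HP_equiv (hn : n < p) (r i : ℕ) :
    ∃ e : relTensor (signRep n k) (permRepHP p k n r i) ≃ₗ[k]
        HP ((PolyFunctor.extPow k n).comp (PolyFunctor.frob p k r)) i,
      ∀ c w, e (relTensorIns (signRep n k) (permRepHP p k n r i) c w) =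
        c • HPmap ((PolyFunctor.extProj k n).whisker (PolyFunctor.frob p k r)) i w := by
  refine exists_character_equiv_HP hn r i _ _ _
    (fun V => extProj_surjective n) (fun V σ => ?_) (fun V => ?_)
  · rw [signRep_one]
    change ((Equiv.Perm.sign σ : ℤ) : k) • extProj k n V ∘ₗ permRep k n V σ = extProj k n V
    refine PiTensorProduct.ext (MultilinearMap.ext fun m => ?_)
    -- The left action of σ on pure tensors precomposes the family m with σ⁻¹.
    have h1 := AlternatingMap.map_perm (exteriorPower.ιMulti k n (M := V)) m σ.symm
    simp only [Function.comp_def] at h1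
    simp only [LinearMap.compMultilinearMap_apply, LinearMap.smul_apply, LinearMap.comp_apply,
      permRep_tprod, extProj_tprod, h1, Equiv.Perm.sign_symm]
    rcases Int.units_eq_one_or (Equiv.Perm.sign σ) with h | h <;> simp [h]
  · refine ⟨exteriorPower.alternatingMapLinearEquiv
      (MultilinearMap.alternatization (PiTensorProduct.tprod k (s := fun _ : Fin n => V))), ?_⟩
    refine PiTensorProduct.ext (MultilinearMap.ext fun m => ?_)
    change exteriorPower.alternatingMapLinearEquiv _ (extProj k n V (PiTensorProduct.tprod k m)) =
      (∑ σ, signRep n k σ 1 • permRep k n V σ) (PiTensorProduct.tprod k m)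
    rw [extProj_tprod, exteriorPower.alternatingMapLinearEquiv_apply_ιMulti,
      MultilinearMap.alternatization_apply, LinearMap.sum_apply]
    -- Alternatization sums over m ∘ σ, the left action over m ∘ σ⁻¹; inversion matches the two sums
    -- and preserves signs.
    refine Fintype.sum_equiv (Equiv.inv _) _ _ fun σ => ?_
    rw [LinearMap.smul_apply, signRep_one, permRep_tprod]
    rcases Int.units_eq_one_or (Equiv.Perm.sign σ) with h | h <;>
      simp [h, Equiv.Perm.inv_def]

end Functors

/-! ### Comparison of one-dimensional Young ideals with characters -/

/-- Equivariantly isomorphic representations have isomorphic relative tensor products. -/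
def relTensorCongr {k G : Type*} [Field k] [Group G] {X Y W : Type*} [AddCommGroup X] [Module k X]
    [AddCommGroup Y] [Module k Y] [AddCommGroup W] [Module k W] {ρ : Representation k G X}
    {ρ' : Representation k G Y} (f : X ≃ₗ[k] Y) (hf : ∀ σ x, f (ρ σ x) = ρ' σ (f x))
    (τ : Representation k G W) : relTensor ρ τ ≃ₗ[k] relTensor ρ' τ :=
  LinearEquiv.ofLinearMap
    (Representation.Coinvariants.lift _
      (Representation.Coinvariants.mk (ρ'.tprod τ) ∘ₗ f.toLinearMap.rTensor W) fun σ =>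
      TensorProduct.ext' fun x w => by
        simpa [hf] using Representation.Coinvariants.mk_self_apply (ρ'.tprod τ) σ (f x ⊗ₜ w))
    (Representation.Coinvariants.lift _
      (Representation.Coinvariants.mk (ρ.tprod τ) ∘ₗ f.symm.toLinearMap.rTensor W) fun σ =>
      TensorProduct.ext' fun y w => by
        have h : f.symm (ρ' σ y) = ρ σ (f.symm y) := by
          rw [LinearEquiv.symm_apply_eq, hf, LinearEquiv.apply_symm_apply]
        simpa [h] using Representation.Coinvariants.mk_self_apply (ρ.tprod τ) σ (f.symm y ⊗ₜ w))
    (Representation.Coinvariants.hom_ext (TensorProduct.ext' fun y w => by simp))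
    (Representation.Coinvariants.hom_ext (TensorProduct.ext' fun x w => by simp))

section Young

variable {k : Type u} [Field k] {n : ℕ} {lam : n.Partition}

/-- If the Young symmetrizer is nonzero and spans a one-dimensional representation of `𝔖_n`, then
this representation is the left ideal which it generates. -/
lemma exists_equiv_youngIdeal (t : Tableau lam) (ρ : Representation k (Equiv.Perm (Fin n)) k)
    (h0 : youngSymmetrizer k t ≠ 0)
    (h : ∀ σ, MonoidAlgebra.of k _ σ * youngSymmetrizer k t = ρ σ 1 • youngSymmetrizer k t) :
    ∃ f : k ≃ₗ[k] youngIdeal k t, ∀ σ c, f (ρ σ c) = youngRep k t σ (f c) := by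
  -- By linearity, the eigenvector property under group elements extends to the whole algebra, so
  -- k𝔖_n c_λ is the line k c_λ.
  have hmem : ∀ y : MonoidAlgebra k (Equiv.Perm (Fin n)),
      ∃ c : k, y * youngSymmetrizer k t = c • youngSymmetrizer k t := by
    intro y
    induction y using MonoidAlgebra.induction_on with
    | of σ => exact ⟨_, h σ⟩
    | add y z hy hz =>
      obtain ⟨c, hc⟩ := hy
      obtain ⟨d, hd⟩ := hz
      exact ⟨c + d, by rw [add_mul, hc, hd, add_smul]⟩
    | smul a y hy =>
      obtain ⟨c, hc⟩ := hy
      exact ⟨a * c, by rw [smul_mul_assoc, hc, mul_smul]⟩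
  -- The multiple c · c_λ lies in the left ideal as the product of the scalar c of the group algebra
  -- with c_λ.
  let g : k →ₗ[k] youngIdeal k t :=
    (LinearMap.toSpanSingleton k _ (youngSymmetrizer k t)).codRestrict _ fun c =>
      ⟨algebraMap k _ c, by
        rw [LinearMap.mulRight_apply, LinearMap.toSpanSingleton_apply, Algebra.smul_def]⟩
  have hg : ∀ c, (g c : MonoidAlgebra k (Equiv.Perm (Fin n))) = c • youngSymmetrizer k t :=
    fun c => rfl
  have hbij : Function.Bijective g := by
    constructor
    · intro c d hcd
      exact smul_left_injective k h0 (congrArg Subtype.val hcd)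
    · rintro ⟨_, y, rfl⟩
      obtain ⟨c, hc⟩ := hmem y
      exact ⟨c, Subtype.ext hc.symm⟩
  refine ⟨LinearEquiv.ofBijective g hbij, fun σ c => Subtype.ext ?_⟩
  change (ρ σ c) • youngSymmetrizer k t =
    MonoidAlgebra.of k _ σ * (c • youngSymmetrizer k t)
  rw [mul_smul_comm, h, smul_smul, ← smul_eq_mul c, ← map_smul, smul_eq_mul, mul_one]

/-- These two bounds confine the boxes to one row when there is a single part, and to one column
when all parts are 1. -/
lemma exists_fst_lt_parts {c : ℕ × ℕ} (hc : c ∈ (diagram lam).cells) :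
    ∃ h : c.1 < (lam.parts.sort (· ≥ ·)).length, c.2 < (lam.parts.sort (· ≥ ·))[c.1] :=
  YoungDiagram.mem_ofRowLens.mp hc

lemma row_eq_zero_of_indiscrete (t : Tableau (Nat.Partition.indiscrete n)) (j : Fin n) :
    (t j).1.1 = 0 := by
  obtain ⟨h, -⟩ := exists_fst_lt_parts (t j).2
  -- The partition (n) has exactly one part only for n ≠ 0; the existence of j excludes the empty
  -- diagram.
  have hn : n ≠ 0 := fun h => by subst h; exact j.elim0
  rw [Multiset.length_sort, Nat.Partition.indiscrete_parts hn, Multiset.card_singleton] at h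
  exact Nat.lt_one_iff.mp h

lemma col_eq_zero_of_ones (t : Tableau (onesPartition n)) (j : Fin n) : (t j).1.2 = 0 := by
  obtain ⟨h, h'⟩ := exists_fst_lt_parts (t j).2
  have h1 : ∀ a ∈ (onesPartition n).parts, a = 1 := fun a ha =>
    Multiset.eq_of_mem_replicate (Multiset.mem_of_mem_filter ha)
  rw [h1 _ ((Multiset.mem_sort _).mp (List.getElem_mem h))] at h'
  exact Nat.lt_one_iff.mp h'

/-- With a single row every permutation preserves rows, while a permutation preserving columns fixes
each box. Hence a_λ is the full sum and b_λ = 1, for every numbering. -/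
lemma youngSymmetrizer_indiscrete (t : Tableau (Nat.Partition.indiscrete n)) :
    youngSymmetrizer k t = ∑ σ : Equiv.Perm (Fin n), MonoidAlgebra.of k _ σ := by
  classical
  have h1 : rowSum k t = ∑ σ : Equiv.Perm (Fin n), MonoidAlgebra.of k _ σ := by
    rw [rowSum, Finset.filter_true_of_mem]
    intro σ _ j
    rw [row_eq_zero_of_indiscrete, row_eq_zero_of_indiscrete]
  have h2 : colSum k t = 1 := by
    rw [colSum, Finset.sum_eq_single_of_mem 1]
    · simp [MonoidAlgebra.one_def]
    · simp
    · intro σ hσ hne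
      refine absurd (Equiv.ext fun j => t.injective (Subtype.ext (Prod.ext ?_ ?_))) hne
      · rw [row_eq_zero_of_indiscrete, row_eq_zero_of_indiscrete]
      · simpa using (Finset.mem_filter.mp hσ).2 j
  rw [youngSymmetrizer, h1, h2, mul_one]

/-- The transposed situation: with a single column b_λ is the full signed sum, and a permutation
preserving rows fixes each box, so a_λ = 1. -/
lemma youngSymmetrizer_ones (t : Tableau (onesPartition n)) :
    youngSymmetrizer k t =
      ∑ σ : Equiv.Perm (Fin n), ((Equiv.Perm.sign σ : ℤ) : k) • MonoidAlgebra.of k _ σ := by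
  classical
  have h1 : colSum k t =
      ∑ σ : Equiv.Perm (Fin n), ((Equiv.Perm.sign σ : ℤ) : k) • MonoidAlgebra.of k _ σ := by
    rw [colSum, Finset.filter_true_of_mem]
    intro σ _ j
    rw [col_eq_zero_of_ones, col_eq_zero_of_ones]
  have h2 : rowSum k t = 1 := by
    rw [rowSum, Finset.sum_eq_single_of_mem 1]
    · simp [MonoidAlgebra.one_def]
    · simp
    · intro σ hσ hne
      refine absurd (Equiv.ext fun j => t.injective (Subtype.ext (Prod.ext ?_ ?_))) hne
      · simpa using (Finset.mem_filter.mp hσ).2 j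
      · rw [col_eq_zero_of_ones, col_eq_zero_of_ones]
  rw [youngSymmetrizer, h1, h2, one_mul]

/-- Group elements form a basis of the group algebra, so one nonzero coefficient suffices. It yields
c_λ ≠ 0 for a single row or column, where the coefficient at the identity is 1. -/
lemma sum_smul_of_ne_zero {G : Type*} [Group G] [Fintype G] (a : G → k) (h : a 1 ≠ 0) :
    ∑ σ : G, a σ • MonoidAlgebra.of k G σ ≠ 0 := by
  intro h0
  classical
  apply h
  have h1 : ∑ σ : G, MonoidAlgebra.single σ (a σ) = 0 := by simpa using h0
  have h2 := congrArg (fun x => MonoidAlgebra.coeff x (1 : G)) h1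
  simpa [Finsupp.single_apply] using h2

lemma exists_equiv_youngIdeal_indiscrete (t : Tableau (Nat.Partition.indiscrete n)) :
    ∃ f : k ≃ₗ[k] youngIdeal k t, ∀ σ c,
      f (Representation.trivial k (Equiv.Perm (Fin n)) k σ c) = youngRep k t σ (f c) := by
  refine exists_equiv_youngIdeal t _ ?_ fun σ => ?_
  · rw [youngSymmetrizer_indiscrete]
    simpa using sum_smul_of_ne_zero (k := k) (fun _ : Equiv.Perm (Fin n) => 1) one_ne_zero
  · rw [youngSymmetrizer_indiscrete, Finset.mul_sum]
    refine Eq.trans ?_ (one_smul k _).symm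
    -- Left multiplication by σ permutes the summands, so σ fixes c_λ.
    refine Fintype.sum_equiv (Equiv.mulLeft σ) _ _ fun τ => ?_
    rw [Equiv.coe_mulLeft, map_mul]

lemma exists_equiv_youngIdeal_ones (t : Tableau (onesPartition n)) :
    ∃ f : k ≃ₗ[k] youngIdeal k t, ∀ σ c, f (signRep n k σ c) = youngRep k t σ (f c) := by
  refine exists_equiv_youngIdeal t _ ?_ fun σ => ?_
  · rw [youngSymmetrizer_ones]
    exact sum_smul_of_ne_zero (fun σ : Equiv.Perm (Fin n) => ((Equiv.Perm.sign σ : ℤ) : k))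
      (by simp)
  · rw [youngSymmetrizer_ones, Finset.mul_sum, Finset.smul_sum, signRep_one]
    refine Fintype.sum_equiv (Equiv.mulLeft σ) _ _ fun τ => ?_
    rw [Equiv.coe_mulLeft, map_mul (MonoidAlgebra.of k _), mul_smul_comm, smul_smul,
      map_mul Equiv.Perm.sign]
    congr 1
    -- The coefficients agree because sgn(σ) sgn(στ) = sgn(τ), the square of a sign being 1.
    rcases Int.units_eq_one_or (Equiv.Perm.sign σ) with h | h <;> simp [h]

end Young

end StrictPoly

end


theorem mainTheorem10 {p : ℕ} [Fact p.Prime] (k : Type u) [Field k] [CharP k p] (n r : ℕ)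
    (hn : n < p) :
    (∀ (lam : n.Partition) (t : Tableau lam) (i : ℕ),
      ∃ e : schur k t (permRepHP p k n r i) ≃ₗ[k]
          HP ((schurFunctor k t).comp (PolyFunctor.frob p k r)) i,
        ∀ (x : youngIdeal k t) (w : HP ((PolyFunctor.tensorPow k n).comp (PolyFunctor.frob p k r)) i),
          e (relTensorIns (youngRep k t) (permRepHP p k n r i) x w) =
            HPmap ((schurIns k t x).whisker (PolyFunctor.frob p k r)) i w) ∧
    (∀ i : ℕ,
      (∀ t : Tableau (Nat.Partition.indiscrete n),
        Nonempty (HP ((PolyFunctor.symPow k n).comp (PolyFunctor.frob p k r)) i ≃ₗ[k]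
          schur k t (permRepHP p k n r i))) ∧
      ∃ e : relTensor (Representation.trivial k (Equiv.Perm (Fin n)) k) (permRepHP p k n r i) ≃ₗ[k]
          HP ((PolyFunctor.symPow k n).comp (PolyFunctor.frob p k r)) i,
        ∀ (c : k) (w : HP ((PolyFunctor.tensorPow k n).comp (PolyFunctor.frob p k r)) i),
          e (relTensorIns (Representation.trivial k (Equiv.Perm (Fin n)) k) (permRepHP p k n r i)
              c w) =
            c • HPmap ((PolyFunctor.symProj k n).whisker (PolyFunctor.frob p k r)) i w) ∧
    (∀ i : ℕ,
      (∀ t : Tableau (onesPartition n),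
        Nonempty (HP ((PolyFunctor.extPow k n).comp (PolyFunctor.frob p k r)) i ≃ₗ[k]
          schur k t (permRepHP p k n r i))) ∧
      ∃ e : relTensor (signRep n k) (permRepHP p k n r i) ≃ₗ[k]
          HP ((PolyFunctor.extPow k n).comp (PolyFunctor.frob p k r)) i,
        ∀ (c : k) (w : HP ((PolyFunctor.tensorPow k n).comp (PolyFunctor.frob p k r)) i),
          e (relTensorIns (signRep n k) (permRepHP p k n r i) c w) =
            c • HPmap ((PolyFunctor.extProj k n).whisker (PolyFunctor.frob p k r)) i w) := by
  -- S^λ is by definition the relative tensor power attached to the representation k𝔖_n c_λ. For S^n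
  -- and Λ^n the isomorphism with the explicit formula comes from the character, and the one with
  -- s^λ is obtained from it by identifying the character with the Young ideal.
  refine ⟨fun lam t i => relTensorPow_HP_equiv hn r i (youngRep k t), fun i => ?_, fun i => ?_⟩
  · obtain ⟨e, he⟩ := symPow_HP_equiv (k := k) hn r i
    refine ⟨fun t => ?_, e, he⟩
    obtain ⟨f, hf⟩ := exists_equiv_youngIdeal_indiscrete (k := k) t
    exact ⟨e.symm ≪≫ₗ relTensorCongr f hf _⟩
  · obtain ⟨e, he⟩ := extPow_HP_equiv (k := k) hn r i
    refine ⟨fun t => ?_, e, he⟩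
    obtain ⟨f, hf⟩ := exists_equiv_youngIdeal_ones (k := k) t
    exact ⟨e.symm ≪≫ₗ relTensorCongr f hf _⟩
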